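/- **Theorem (multiple Bailey transformations for terminating series of type (B)).** Let $[x]$ be a nonzero entire odd function on $\mathbb{C}$ satisfying the Riemann relation $$[x+y][x-y][u+v][u-v]=[x+u][x-u][y+v][y-v]-[x+v][x-v][y+u][y-u],$$ and let $\delta\in\mathbb{C}$ be such that $[k\delta]\neq0$ for every nonzero integer $k$. Put $[x]_k=\prod_{j=0}^{k-1}[x+j\delta]$ for $k\in\mathbb N=\{0,1,2,\dots\}$, $\Delta(z)=\prod_{i<j}[z_i-z_j]$, and $|\mu|=\mu_1+\cdots+\mu_m$. For $a,x\in\mathbb{C}^m$, $s\in\mathbb{C}$, $u,v\in\mathbb{C}^n$ let $$E^{m,n}\Big(\begin{matrix}a\\x\end{matrix}\Big|\,s;u;v\Big)=\sum_{\mu\in\mathbb{N}^m}\frac{\Delta(x+\mu\delta)}{\Delta(x)}\prod_{i=1}^m\frac{[x_i+s+(|\mu|+\mu_i)\delta]}{[x_i+s]}\prod_{j=1}^m\Big(\frac{[s+x_j]_{|\mu|}}{[\delta+s+x_j-a_j]_{|\mu|}}\prod_{i=1}^m\frac{[x_i-x_j+a_j]_{\mu_i}}{[x_i-x_j+\delta]_{\mu_i}}\Big)\prod_{k=1}^n\Big(\frac{[v_k]_{|\mu|}}{[\delta+s-u_k]_{|\mu|}}\prod_{i=1}^m\frac{[x_i+u_k]_{\mu_i}}{[x_i+\delta+s-v_k]_{\mu_i}}\Big).$$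 Let $a,x\in\mathbb{C}^m$ and $s,c_k,d_k\in\mathbb{C}$ $(k=0,1,2)$ satisfy the balancing condition $$\sum_{i=1}^m a_i+\sum_{k=0}^2(c_k+d_k)=2\delta+3s$$ and the termination condition $a_i=-\alpha_i\delta$ $(i=1,\dots,m)$ for some $\alpha\in\mathbb{N}^m$ (so that only the terms with $\mu\le\alpha$ componentwise contribute to the series below). Write $|a|=a_1+\cdots+a_m$. Then the following two identities hold, each one at all parameter values for which no denominator vanishes in its prefactor or in the terms with $\mu\le\alpha$ of its two series. (I) With $\widetilde s=\delta+2s-c_2-d_0-d_1$, $\widetilde c_2=\delta+s-d_0-d_1$, $\widetilde d_0=\delta+s-c_2-d_1$, $\widetilde d_1=\delta+s-c_2-d_0$, $$E^{m,3}\Big(\begin{matrix}a\\x\end{matrix}\Big|\,\widetilde s;c_0,c_1,\widetilde c_2;\widetilde d_0,\widetilde d_1,d_2\Big)=\frac{[\delta+s-c_0]_{|\alpha|}[\delta+s-c_1]_{|\alpha|}}{[\delta+s-c_0-d_2]_{|\alpha|}[\delta+s-c_1-d_2]_{|\alpha|}}\prod_{i=1}^m\frac{[\delta+s+x_i-d_2]_{\alpha_i}[\delta+s-x_i+a_i-|a|-c_0-c_1-d_2]_{\alpha_i}}{[\delta+s+x_i]_{\alpha_i}[\delta+s-x_i+a_i-|a|-c_0-c_1]_{\alpha_i}}\;E^{m,3}\Big(\begin{matrix}a\\x\end{matrix}\Big|\,s;c_0,c_1,c_2;d_0,d_1,d_2\Big).$$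 (II) With $\widetilde s=\delta+2s-c_0-c_1-c_2$, $\widetilde c_0=\delta+s-c_1-c_2$, $\widetilde c_1=\delta+s-c_0-c_2$, $\widetilde c_2=\delta+s-c_0-c_1$, $\widetilde x_i=a_i-x_i-|a|$, $$E^{m,3}\Big(\begin{matrix}a\\\widetilde x\end{matrix}\Big|\,\widetilde s;\widetilde c_0,\widetilde c_1,\widetilde c_2;d_0,d_1,d_2\Big)=\prod_{i=1}^m\frac{[\delta+s+x_i-d_0]_{\alpha_i}[\delta+s+x_i-d_1]_{\alpha_i}}{[\delta+s+x_i]_{\alpha_i}[\delta+s+x_i-d_0-d_1]_{\alpha_i}}\prod_{i=1}^m\frac{[\delta+s+x_i-d_2]_{\alpha_i}[\delta+s+x_i-d_0-d_1-d_2]_{\alpha_i}}{[\delta+s+x_i-d_0-d_2]_{\alpha_i}[\delta+s+x_i-d_1-d_2]_{\alpha_i}}\;E^{m,3}\Big(\begin{matrix}a\\x\end{matrix}\Big|\,s;c_0,c_1,c_2;d_0,d_1,d_2\Big).$$ -/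

import Mathlib

/-- `f`, written `[x]` on paper, is a nonzero entire odd function satisfying the Riemann relation. -/
structure IsRiemannBracket (f : ℂ → ℂ) : Prop where
  holomorphic : Differentiable ℂ f
  ne_zero : f ≠ 0
  odd : ∀ x, f (-x) = -f x
  riemann : ∀ x y u v : ℂ,
    f (x + y) * f (x - y) * f (u + v) * f (u - v) =
      f (x + u) * f (x - u) * f (y + v) * f (y - v) -
        f (x + v) * f (x - v) * f (y + u) * f (y - u)

/-- The shifted factorial `[x]_k = [x][x + δ] ⋯ [x + (k - 1)δ]`. -/
noncomputable def shiftedFactorial (f : ℂ → ℂ) (δ x : ℂ) (k : ℕ) : ℂ :=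
  ∏ j ∈ Finset.range k, f (x + (j : ℂ) * δ)

/-- The difference product `Δ(z) = ∏_{i < j} [z_i - z_j]`. -/
noncomputable def differenceProduct (f : ℂ → ℂ) {m : ℕ} (z : Fin m → ℂ) : ℂ :=
  ∏ i, ∏ j ∈ Finset.Ioi i, f (z i - z j)

/-- The term with index `μ` of the very well-poised multiple series
`E^{m,n}(a_1, …, a_m; x_1, …, x_m | s; u_1, …, u_n; v_1, …, v_n)`. -/
noncomputable def vwpTerm (f : ℂ → ℂ) (δ : ℂ) {m n : ℕ} (a x : Fin m → ℂ) (s : ℂ)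
    (u v : Fin n → ℂ) (μ : Fin m → ℕ) : ℂ :=
  differenceProduct f (fun i => x i + (μ i : ℂ) * δ) / differenceProduct f x *
    (∏ i, f (x i + s + (((∑ j, μ j) + μ i : ℕ) : ℂ) * δ) / f (x i + s)) *
    (∏ j, (shiftedFactorial f δ (s + x j) (∑ l, μ l) /
        shiftedFactorial f δ (δ + s + x j - a j) (∑ l, μ l) *
      ∏ i, shiftedFactorial f δ (x i - x j + a j) (μ i) /
        shiftedFactorial f δ (x i - x j + δ) (μ i))) *
    (∏ k, (shiftedFactorial f δ (v k) (∑ l, μ l) /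
        shiftedFactorial f δ (δ + s - u k) (∑ l, μ l) *
      ∏ i, shiftedFactorial f δ (x i + u k) (μ i) /
        shiftedFactorial f δ (x i + δ + s - v k) (μ i)))

/-- The very well-poised multiple hypergeometric series `E^{m,n}`, summed over all `μ ∈ ℕ^m`. -/
noncomputable def vwpSeries (f : ℂ → ℂ) (δ : ℂ) {m n : ℕ} (a x : Fin m → ℂ) (s : ℂ)
    (u v : Fin n → ℂ) : ℂ :=
  ∑' μ : Fin m → ℕ, vwpTerm f δ a x s u v μ

/-- No denominator vanishes in the terms of `E^{m,n}` with index `μ ≤ α`. -/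
structure VwpRegular (f : ℂ → ℂ) (δ : ℂ) {m n : ℕ} (a x : Fin m → ℂ) (s : ℂ)
    (u v : Fin n → ℂ) (α : Fin m → ℕ) : Prop where
  difference_ne : differenceProduct f x ≠ 0
  base_ne : ∀ i, f (x i + s) ≠ 0
  a_ne : ∀ μ ≤ α, ∀ j, shiftedFactorial f δ (δ + s + x j - a j) (∑ l, μ l) ≠ 0
  x_ne : ∀ μ ≤ α, ∀ i j, shiftedFactorial f δ (x i - x j + δ) (μ i) ≠ 0
  u_ne : ∀ μ ≤ α, ∀ k, shiftedFactorial f δ (δ + s - u k) (∑ l, μ l) ≠ 0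
  v_ne : ∀ μ ≤ α, ∀ i k, shiftedFactorial f δ (x i + δ + s - v k) (μ i) ≠ 0

/-- If `a_i = -α_i δ` for all `i`, only the terms with `μ ≤ α` contribute: the series terminates. -/
theorem vwpSeries_eq_sum {f : ℂ → ℂ} (hf : IsRiemannBracket f) (δ : ℂ) {m n : ℕ}
    (a x : Fin m → ℂ) (s : ℂ) (u v : Fin n → ℂ) (α : Fin m → ℕ)
    (ha : ∀ i, a i = -(α i : ℂ) * δ) :
    vwpSeries f δ a x s u v = ∑ μ ∈ Finset.Iic α, vwpTerm f δ a x s u v μ := by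
  have h0 : f 0 = 0 := by
    have h := hf.odd 0
    rw [neg_zero] at h
    exact self_eq_neg.mp h
  refine tsum_eq_sum fun μ hμ => ?_
  obtain ⟨j, hj⟩ : ∃ j, α j < μ j := by
    simpa [Pi.le_def] using hμ
  have hz : shiftedFactorial f δ (x j - x j + a j) (μ j) = 0 :=
    Finset.prod_eq_zero (Finset.mem_range.mpr hj) (by
      rw [ha j, show x j - x j + -(α j : ℂ) * δ + (α j : ℂ) * δ = 0 by ring, h0])
  have hp : (∏ i, shiftedFactorial f δ (x i - x j + a j) (μ i) /
      shiftedFactorial f δ (x i - x j + δ) (μ i)) = 0 :=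
    Finset.prod_eq_zero (Finset.mem_univ j) (by rw [hz, zero_div])
  have hq : (∏ j, (shiftedFactorial f δ (s + x j) (∑ l, μ l) /
        shiftedFactorial f δ (δ + s + x j - a j) (∑ l, μ l) *
      ∏ i, shiftedFactorial f δ (x i - x j + a j) (μ i) /
        shiftedFactorial f δ (x i - x j + δ) (μ i))) = 0 :=
    Finset.prod_eq_zero (Finset.mem_univ j) (by rw [hp, mul_zero])
  rw [vwpTerm, hq, mul_zero, zero_mul]

open Finset MeasureTheory Topology Filter

/-! ### Zeros of the bracket and shifted factorials -/

/-! Multiplying a terminating E^{m,3} by the right shifted factorials gives a finite sum,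
`normalizedSeries`, whose terms are entire in all c_k and d_k. In this normalisation both
transformations say that two series are equal; the prefactors are ratios of the normalising factors,
rewritten by reflection of shifted factorials.

For (I), fix D = d₀ + d₁ and let z = d₀ vary. Both sides are invariant under z ↦ D - z, and by the
Riemann relation each product [t - z][t - (D - z)] is, up to a common factor, affine in one quotient
of two such products. So both sides behave like polynomials of degree at most |α| in one variable
(`EvenTheta`), and agreement at |α| + 1 independent points suffices (`EvenTheta.eq_zero`). At the
|α| points z = x_i + s + pδ, 1 ≤ p ≤ α_i, the terms with μ_i < p vanish and the rest is a series of
the same kind with α_i lowered by p (`normalizedSeries_add_single`), which an induction on |α|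
handles. One more point is needed. For the Jackson sum (`normalizedSeries_jackson`) it is z = 0,
where only the term μ = 0 survives. For the Bailey transformation (`normalizedSeries_bailey`) it is
z = δ + s - c₂, where one side is a Jackson sum and the other a single term.

For (II), the Bailey transformation is applied three times, with c₂, c₁, c₀ as distinguished
parameters, and then the summation is reversed, μ ↦ α - μ, which exchanges the c's and the d's
(`normalizedSeries_reverse`).

All this needs generic parameters, so that the points are independent and no denominator vanishes.
The general case follows by continuity along a complex line in the balanced parameter space, almost
every point of which is generic. -/

theorem IsRiemannBracket.map_zero {f : ℂ → ℂ} (hf : IsRiemannBracket f) : f 0 = 0 := by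
  have h := hf.odd 0
  rw [neg_zero] at h
  exact self_eq_neg.mp h

section ShiftedFactorial

variable (f : ℂ → ℂ) (δ : ℂ)

@[simp]
theorem shiftedFactorial_zero (x : ℂ) : shiftedFactorial f δ x 0 = 1 := by
  simp [shiftedFactorial]

theorem shiftedFactorial_add (x : ℂ) (m n : ℕ) :
    shiftedFactorial f δ x (m + n) =
      shiftedFactorial f δ x m * shiftedFactorial f δ (x + m * δ) n := by
  simp only [shiftedFactorial, prod_range_add, Nat.cast_add]
  congr 1
  exact prod_congr rfl fun j _ => congrArg f (by ring)

/-- The two ways of splitting `[x]_{m+n}`. -/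
theorem shiftedFactorial_mul_comm (x : ℂ) (m n : ℕ) :
    shiftedFactorial f δ x m * shiftedFactorial f δ (x + m * δ) n =
      shiftedFactorial f δ x n * shiftedFactorial f δ (x + n * δ) m := by
  rw [← shiftedFactorial_add, ← shiftedFactorial_add, add_comm]

variable {f}

theorem shiftedFactorial_reflect (hf : ∀ x, f (-x) = -f x) (x : ℂ) (k : ℕ) :
    shiftedFactorial f δ x k = (-1) ^ k * shiftedFactorial f δ (δ - x - k * δ) k := by
  rw [shiftedFactorial, shiftedFactorial, ← prod_range_reflect]
  conv_lhs => rw [← one_mul (∏ j ∈ range k, _)]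
  conv_rhs => rw [← card_range k, ← prod_const, card_range, ← prod_mul_distrib]
  rw [one_mul]
  refine prod_congr rfl fun j hj => ?_
  have hj' : j + 1 ≤ k := mem_range.mp hj
  rw [show ((k - 1 - j : ℕ) : ℂ) = k - 1 - j by
    rw [show k - 1 - j = k - (j + 1) by omega, Nat.cast_sub hj']; push_cast; ring,
    neg_one_mul, ← hf]
  exact congrArg f (by ring)

theorem shiftedFactorial_ne_zero {δ x : ℂ} {k : ℕ} (h : ∀ j < k, f (x + j * δ) ≠ 0) :
    shiftedFactorial f δ x k ≠ 0 :=
  prod_ne_zero_iff.mpr fun j hj => h j (mem_range.mp hj)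

theorem shiftedFactorial_eq_zero {δ x : ℂ} {k j : ℕ} (hj : j < k) (h : f (x + j * δ) = 0) :
    shiftedFactorial f δ x k = 0 :=
  prod_eq_zero (mem_range.mpr hj) h

end ShiftedFactorial

/-! ### Generic points -/

/-- `[w + tδ]` does not vanish for any integer `t`. -/
def Avoids (f : ℂ → ℂ) (δ w : ℂ) : Prop :=
  ∀ t : ℤ, f (w + t * δ) ≠ 0

namespace Avoids

variable {f : ℂ → ℂ} {δ w w' : ℂ}

theorem ne (h : Avoids f δ w) (t : ℤ) (hw : w' = w + t * δ) : f w' ≠ 0 :=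
  hw ▸ h t

theorem shift (h : Avoids f δ w) (t : ℤ) (hw : w' = w + t * δ) : Avoids f δ w' := fun t' =>
  h.ne (t + t') (by rw [hw]; push_cast; ring)

theorem shiftedFactorial_ne (h : Avoids f δ w) (t : ℤ) (k : ℕ) (hw : w' = w + t * δ) :
    shiftedFactorial f δ w' k ≠ 0 :=
  shiftedFactorial_ne_zero fun j _ => h.ne (t + j) (by rw [hw]; push_cast; ring)

end Avoids

/-- By the identity theorem the zeros of a nonzero entire function form a closed discrete set, which
is Lebesgue null. Null sets let countably many genericity conditions be imposed at once. -/
theorem IsRiemannBracket.ae_affine_ne_zero {f : ℂ → ℂ} (hf : IsRiemannBracket f) (A : ℂ) {B : ℂ}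
    (hB : B ≠ 0) : ∀ᵐ z : ℂ, f (A + z * B) ≠ 0 := by
  have hB' : HasDerivAt (fun z : ℂ => A + z * B) B 0 := by
    simpa using ((hasDerivAt_id (0 : ℂ)).mul_const B).const_add A
  have han : AnalyticOnNhd ℂ (fun z => f (A + z * B)) Set.univ := fun z _ =>
    (hf.holomorphic.comp (by fun_prop : Differentiable ℂ fun z : ℂ => A + z * B)).analyticAt z
  have hne : (fun z => f (A + z * B)) ≠ 0 := fun h => hf.ne_zero <| funext fun w => by
    have := congrFun h ((w - A) / B)
    simpa [div_mul_cancel₀ _ hB] using this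
  have hcod : {z | f (A + z * B) ≠ 0} ∈ codiscrete ℂ := by
    rcases han.eqOn_zero_or_eventually_ne_zero_of_preconnected isPreconnected_univ with h | h
    · exact absurd (funext fun z => h (Set.mem_univ z)) hne
    · exact h
  have := ae_restrict_le_codiscreteWithin (μ := (volume : Measure ℂ)) MeasurableSet.univ hcod
  rwa [Measure.restrict_univ] at this

theorem IsRiemannBracket.ae_avoids {f : ℂ → ℂ} (hf : IsRiemannBracket f) (δ A : ℂ) {B : ℂ}
    (hB : B ≠ 0) : ∀ᵐ z : ℂ, Avoids f δ (A + z * B) := by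
  refine ae_all_iff.mpr fun t => ?_
  filter_upwards [hf.ae_affine_ne_zero (A + t * δ) hB] with z hz
  rwa [show A + z * B + t * δ = A + t * δ + z * B by ring]

/-! ### Interpolation of even theta functions -/

/-- `F` behaves like a linear combination of products of `n` functions
`z ↦ [t - z][t - (D - z)]`: after division by `n` copies of one such function it becomes a
polynomial of degree at most `n` in a quotient of two of them. -/
def EvenTheta (f : ℂ → ℂ) (D : ℂ) (n : ℕ) (F : ℂ → ℂ) : Prop :=
  ∀ u v : ℂ, ∃ h : Polynomial ℂ, h.natDegree ≤ n ∧ ∀ z : ℂ,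
    f (z - D / 2 + u) * f (z - D / 2 - u) ≠ 0 →
    F z * (f (u + v) * f (u - v)) ^ n =
      (f (z - D / 2 + u) * f (z - D / 2 - u)) ^ n *
        h.eval (f (z - D / 2 + v) * f (z - D / 2 - v) / (f (z - D / 2 + u) * f (z - D / 2 - u)))

namespace EvenTheta

variable {f : ℂ → ℂ} {D : ℂ}

theorem const (c : ℂ) : EvenTheta f D 0 fun _ => c := fun u v =>
  ⟨Polynomial.C c, by simp, fun z _ => by simp⟩

theorem add {n : ℕ} {F G : ℂ → ℂ} (hF : EvenTheta f D n F) (hG : EvenTheta f D n G) :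
    EvenTheta f D n fun z => F z + G z := fun u v => by
  obtain ⟨p, hp, hp'⟩ := hF u v
  obtain ⟨q, hq, hq'⟩ := hG u v
  refine ⟨p + q, Polynomial.natDegree_add_le_of_degree_le hp hq, fun z hz => ?_⟩
  rw [Polynomial.eval_add, add_mul, hp' z hz, hq' z hz, mul_add]

theorem mul {n k : ℕ} {F G : ℂ → ℂ} (hF : EvenTheta f D n F) (hG : EvenTheta f D k G) :
    EvenTheta f D (n + k) fun z => F z * G z := fun u v => by
  obtain ⟨p, hp, hp'⟩ := hF u v
  obtain ⟨q, hq, hq'⟩ := hG u v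
  refine ⟨p * q, Polynomial.natDegree_mul_le_of_le hp hq, fun z hz => ?_⟩
  rw [Polynomial.eval_mul, pow_add, mul_mul_mul_comm, hp' z hz, hq' z hz]
  ring

theorem const_mul {n : ℕ} {F : ℂ → ℂ} (hF : EvenTheta f D n F) (c : ℂ) :
    EvenTheta f D n fun z => c * F z := by
  simpa using (EvenTheta.const c).mul hF

theorem zero (n : ℕ) : EvenTheta f D n fun _ => 0 := fun u v =>
  ⟨0, by simp, fun z _ => by simp⟩

theorem sum {ι : Type*} {n : ℕ} {F : ι → ℂ → ℂ} (s : Finset ι)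
    (h : ∀ i ∈ s, EvenTheta f D n (F i)) : EvenTheta f D n fun z => ∑ i ∈ s, F i z := by
  classical
  induction s using Finset.induction_on with
  | empty => simpa using EvenTheta.zero n
  | insert i s hi ih =>
    simp only [sum_insert hi]
    exact (h i (mem_insert_self i s)).add (ih fun j hj => h j (mem_insert_of_mem hj))

theorem prod {ι : Type*} {n : ι → ℕ} {F : ι → ℂ → ℂ} (s : Finset ι)
    (h : ∀ i ∈ s, EvenTheta f D (n i) (F i)) :
    EvenTheta f D (∑ i ∈ s, n i) fun z => ∏ i ∈ s, F i z := by
  classical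
  induction s using Finset.induction_on with
  | empty => simpa using EvenTheta.const (f := f) (D := D) 1
  | insert i s hi ih =>
    simp only [prod_insert hi, sum_insert hi]
    exact (h i (mem_insert_self i s)).mul (ih fun j hj => h j (mem_insert_of_mem hj))

/-- This is the Riemann relation at x = t - D/2, y = z - D/2, divided by [y + u][y - u]. -/
theorem pair (hf : IsRiemannBracket f) (t : ℂ) :
    EvenTheta f D 1 fun z => f (t - z) * f (t - (D - z)) := fun u v => by
  set τ := t - D / 2 with hτ
  refine ⟨Polynomial.C (f (τ + u) * f (τ - u)) * Polynomial.X -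
    Polynomial.C (f (τ + v) * f (τ - v)), ?_, fun z hz => ?_⟩
  · compute_degree
  · have h := hf.riemann τ (z - D / 2) u v
    rw [show τ + (z - D / 2) = t - (D - z) by rw [hτ]; ring,
      show τ - (z - D / 2) = t - z by rw [hτ]; ring] at h
    simp only [Polynomial.eval_sub, Polynomial.eval_mul, Polynomial.eval_C, Polynomial.eval_X,
      pow_one]
    have e := div_mul_cancel₀ (f (z - D / 2 + v) * f (z - D / 2 - v)) hz
    linear_combination h - f (τ + u) * f (τ - u) * e

theorem shiftedFactorial_sub (hf : IsRiemannBracket f) (δ t : ℂ) (k : ℕ) :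
    EvenTheta f D k fun z =>
      shiftedFactorial f δ (t - z) k * shiftedFactorial f δ (t - (D - z)) k := by
  have h := EvenTheta.prod (f := f) (D := D) (n := fun _ => 1)
    (F := fun (j : ℕ) z => f (t + j * δ - z) * f (t + j * δ - (D - z))) (range k)
    fun j _ => pair hf _
  simp only [sum_const, card_range, smul_eq_mul, mul_one] at h
  convert h using 2 with z
  rw [shiftedFactorial, shiftedFactorial, ← prod_mul_distrib]
  refine prod_congr rfl fun j _ => ?_
  congr 2 <;> ring

theorem shiftedFactorial_add (hf : IsRiemannBracket f) (δ r : ℂ) (k : ℕ) :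
    EvenTheta f D k fun z =>
      shiftedFactorial f δ (z + r) k * shiftedFactorial f δ (D - z + r) k := by
  have h := EvenTheta.prod (f := f) (D := D) (n := fun _ => 1)
    (F := fun (j : ℕ) z => f (-(r + j * δ) - z) * f (-(r + j * δ) - (D - z))) (range k)
    fun j _ => pair hf _
  simp only [sum_const, card_range, smul_eq_mul, mul_one] at h
  convert h using 2 with z
  rw [shiftedFactorial, shiftedFactorial, ← prod_mul_distrib]
  refine prod_congr rfl fun j _ => ?_
  rw [show -(r + j * δ) - z = -(z + r + j * δ) by ring,
    show -(r + j * δ) - (D - z) = -(D - z + r + j * δ) by ring, hf.odd, hf.odd]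
  ring

/-- An even theta function of degree `n` vanishing at more than `n` independent points is zero. -/
theorem eq_zero (hf : IsRiemannBracket f) {n : ℕ} {F : ℂ → ℂ} (hF : EvenTheta f D n F)
    {κ : Type*} [Fintype κ] (hκ : n < Fintype.card κ) (z : κ → ℂ) (hz : ∀ p, F (z p) = 0)
    (hsub : ∀ p q, p ≠ q → f (z p - z q) ≠ 0) (hadd : ∀ p q, p ≠ q → f (z p + z q - D) ≠ 0)
    (w : ℂ) : F w = 0 := by
  -- The reference function given by u must not vanish at any node or at w, so that the quotient is
  -- defined at all of them.
  obtain ⟨u, hu, hu'⟩ : ∃ u, (∀ p, f (z p - D / 2 + u) * f (z p - D / 2 - u) ≠ 0) ∧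
      f (w - D / 2 + u) * f (w - D / 2 - u) ≠ 0 := by
    have h1 : ∀ A : ℂ, ∀ᵐ u : ℂ, f (A + u) * f (A - u) ≠ 0 := fun A => by
      filter_upwards [hf.ae_affine_ne_zero A one_ne_zero,
        hf.ae_affine_ne_zero A (neg_ne_zero.mpr one_ne_zero)] with u h1 h2
      exact mul_ne_zero (by simpa using h1) (by simpa [sub_eq_add_neg] using h2)
    exact ((ae_all_iff.mpr fun p => h1 (z p - D / 2)).and (h1 (w - D / 2))).exists
  obtain ⟨v, hv⟩ : ∃ v, f (u + v) * f (u - v) ≠ 0 := by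
    refine Filter.Eventually.exists (f := ae (volume : Measure ℂ)) ?_
    filter_upwards [hf.ae_affine_ne_zero u one_ne_zero,
      hf.ae_affine_ne_zero u (neg_ne_zero.mpr one_ne_zero)] with v h1 h2
    exact mul_ne_zero (by simpa using h1) (by simpa [sub_eq_add_neg] using h2)
  obtain ⟨h, hdeg, hh⟩ := hF u v
  have h0 : h = 0 := by
    refine Polynomial.eq_zero_of_natDegree_lt_card_of_eval_eq_zero h (ι := κ)
      (f := fun p => f (z p - D / 2 + v) * f (z p - D / 2 - v) /
        (f (z p - D / 2 + u) * f (z p - D / 2 - u))) (fun p q hpq => ?_) (fun p => ?_)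
      (hdeg.trans_lt hκ)
    · by_contra hne
      rw [div_eq_div_iff (hu p) (hu q)] at hpq
      -- By the Riemann relation, two nodes with the same quotient would satisfy [z_p + z_q - D][z_p
      -- - z_q][u + v][u - v] = 0. Hence the polynomial has more roots than its degree.
      have hr := hf.riemann (z p - D / 2) (z q - D / 2) u v
      rw [show z p - D / 2 + (z q - D / 2) = z p + z q - D by ring,
        show z p - D / 2 - (z q - D / 2) = z p - z q by ring] at hr
      refine mul_ne_zero (mul_ne_zero (hadd p q hne) (hsub p q hne)) hv ?_
      linear_combination hr - hpq
    · have := hh (z p) (hu p)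
      rw [hz p, zero_mul] at this
      exact (mul_eq_zero.mp this.symm).resolve_left (pow_ne_zero n (hu p))
  have := hh w hu'
  rw [h0, Polynomial.eval_zero, mul_zero] at this
  exact (mul_eq_zero.mp this).resolve_right (pow_ne_zero n hv)

end EvenTheta

/-! ### The normalised series -/

section Normalized

variable (f : ℂ → ℂ) (δ : ℂ) {ι : Type*} [Fintype ι]

/-- The part of the normalised term that depends only on `α` and the differences of `x`. -/
noncomputable def differenceWeight (α : ι → ℕ) (x : ι → ℂ) (μ : ι → ℕ) : ℂ :=
  (-1) ^ (∑ i, μ i) * ∏ i, ∏ j,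
    shiftedFactorial f δ (x i - (x j + α j * δ)) (μ i) /
      shiftedFactorial f δ (x i - (x j + μ j * δ)) (μ i)

/-- The very well-poised part of the normalised term. -/
noncomputable def wellPoisedWeight (α : ι → ℕ) (x : ι → ℂ) (s : ℂ) (μ : ι → ℕ) : ℂ :=
  ∏ i, f (x i + s + (((∑ j, μ j) + μ i : ℕ) : ℂ) * δ) /
    shiftedFactorial f δ (x i + s + ((∑ j, μ j : ℕ) : ℂ) * δ) (α i + 1)

/-- The factor of the normalised term that carries an upper parameter `c` of type `[x_i + c]`. -/
noncomputable def upperWeight (α : ι → ℕ) (x : ι → ℂ) (s c : ℂ) (μ : ι → ℕ) : ℂ :=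
  shiftedFactorial f δ (δ + s - c + ((∑ j, μ j : ℕ) : ℂ) * δ) ((∑ j, α j) - ∑ j, μ j) *
    ∏ i, shiftedFactorial f δ (x i + c) (μ i)

/-- The factor of the normalised term that carries a parameter `d` of type `[d]_{|μ|}`. -/
noncomputable def lowerWeight (α : ι → ℕ) (x : ι → ℂ) (s d : ℂ) (μ : ι → ℕ) : ℂ :=
  shiftedFactorial f δ d (∑ j, μ j) *
    ∏ i, shiftedFactorial f δ (x i + μ i * δ + (δ + s - d)) (α i - μ i)

/-- The term of `E^{m,3}` at `a_i = -α_i δ`, multiplied by a factor that makes it entire in `c`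
and `d`. -/
noncomputable def normalizedTerm (α : ι → ℕ) (x : ι → ℂ) (s : ℂ) (c d : Fin 3 → ℂ)
    (μ : ι → ℕ) : ℂ :=
  differenceWeight f δ α x μ * wellPoisedWeight f δ α x s μ *
    ∏ k, (upperWeight f δ α x s (c k) μ * lowerWeight f δ α x s (d k) μ)

/-- The normalised terminating series. -/
noncomputable def normalizedSeries [DecidableEq ι] (α : ι → ℕ) (x : ι → ℂ) (s : ℂ)
    (c d : Fin 3 → ℂ) : ℂ :=
  ∑ μ ∈ Iic α, normalizedTerm f δ α x s c d μ

end Normalized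

/-! ### Residues -/

section Residue

variable {f : ℂ → ℂ} {δ : ℂ} {ι : Type*} [Fintype ι] [DecidableEq ι]

theorem sum_add_single (κ : ι → ℕ) (i : ι) (p : ℕ) :
    ∑ j, (κ + Pi.single i p : ι → ℕ) j = (∑ j, κ j) + p := by
  simp [sum_add_distrib]

theorem add_single_shift {ι : Type*} [DecidableEq ι] (x : ι → ℂ) (κ : ι → ℕ) (i : ι) (p : ℕ) (l : ι) :
    x l + ((κ + Pi.single i p : ι → ℕ) l : ℂ) * δ =
      (x + Pi.single i ((p : ℂ) * δ) : ι → ℂ) l + κ l * δ := by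
  by_cases h : l = i
  · subst h; simp; ring
  · simp [h]

theorem prod_eq_mul_prod_of_single (i : ι) (E : ℂ) (F G : ι → ℂ) (hi : F i = E * G i)
    (hne : ∀ l, l ≠ i → F l = G l) : ∏ l, F l = E * ∏ l, G l := by
  rw [← mul_prod_erase univ F (mem_univ i), ← mul_prod_erase univ G (mem_univ i), hi, mul_assoc]
  exact congrArg _ (congrArg _ (prod_congr rfl fun l hl => hne l (ne_of_mem_erase hl)))

theorem upperWeight_add_single (α κ : ι → ℕ) (x : ι → ℂ) (s c : ℂ) (i : ι) (p : ℕ) :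
    upperWeight f δ (α + Pi.single i p) x s c (κ + Pi.single i p) =
      shiftedFactorial f δ (x i + c) p *
        upperWeight f δ α (x + Pi.single i ((p : ℂ) * δ)) (s + p * δ) c κ := by
  rw [upperWeight, upperWeight, sum_add_single, sum_add_single, Nat.add_sub_add_right,
    mul_left_comm]
  congr 1
  · congr 1; push_cast; ring
  · refine prod_eq_mul_prod_of_single i _ _ _ ?_ fun l h => ?_
    · simp only [Pi.add_apply, Pi.single_eq_same]
      rw [add_comm (κ i), shiftedFactorial_add]
      congr 2; ring
    · simp [h]

theorem lowerWeight_add_single (α κ : ι → ℕ) (x : ι → ℂ) (s d : ℂ) (i : ι) (p : ℕ) :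
    lowerWeight f δ (α + Pi.single i p) x s d (κ + Pi.single i p) =
      shiftedFactorial f δ d p *
        lowerWeight f δ α (x + Pi.single i ((p : ℂ) * δ)) (s + p * δ) (d + p * δ) κ := by
  rw [lowerWeight, lowerWeight, sum_add_single, add_comm _ p, shiftedFactorial_add, mul_assoc]
  congr 2
  refine prod_congr rfl fun l _ => ?_
  rw [add_single_shift]
  congr 1
  · ring
  · simp only [Pi.add_apply, Nat.add_sub_add_right]

theorem differenceWeight_add_single (α κ : ι → ℕ) (x : ι → ℂ) (i : ι) (p : ℕ) :
    differenceWeight f δ (α + Pi.single i p) x (κ + Pi.single i p) =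
      (-1) ^ p * (∏ j, shiftedFactorial f δ
          (x i - ((x + Pi.single i ((p : ℂ) * δ) : ι → ℂ) j + α j * δ)) p /
        shiftedFactorial f δ (x i - ((x + Pi.single i ((p : ℂ) * δ) : ι → ℂ) j + κ j * δ)) p) *
      differenceWeight f δ α (x + Pi.single i ((p : ℂ) * δ)) κ := by
  rw [differenceWeight, differenceWeight, sum_add_single, pow_add, mul_mul_mul_comm,
    mul_comm ((-1 : ℂ) ^ p)]
  congr 1
  refine prod_eq_mul_prod_of_single i _ _ _ ?_ fun l h => ?_
  · simp only [add_single_shift]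
    rw [← prod_mul_distrib]
    refine prod_congr rfl fun j _ => ?_
    rw [div_mul_div_comm]
    simp only [Pi.add_apply κ, Pi.single_eq_same]
    rw [add_comm (κ i), shiftedFactorial_add, shiftedFactorial_add,
      show (x + Pi.single i ((p : ℂ) * δ) : ι → ℂ) i = x i + p * δ by simp]
    congr 3 <;> ring
  · simp only [add_single_shift]
    simp [h]

theorem wellPoisedWeight_add_single (α κ : ι → ℕ) (x : ι → ℂ) (s : ℂ) (i : ι) (p : ℕ) :
    wellPoisedWeight f δ (α + Pi.single i p) x s (κ + Pi.single i p) =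
      (shiftedFactorial f δ (x i + s + p * δ + ((∑ j, κ j : ℕ) : ℂ) * δ) p)⁻¹ *
        wellPoisedWeight f δ α (x + Pi.single i ((p : ℂ) * δ)) (s + p * δ) κ := by
  rw [wellPoisedWeight, wellPoisedWeight, sum_add_single]
  refine prod_eq_mul_prod_of_single i _ _ _ ?_ fun l h => ?_
  · simp only [Pi.add_apply, Pi.single_eq_same]
    rw [show α i + p + 1 = p + (α i + 1) by ring, shiftedFactorial_add, inv_mul_eq_div,
      div_div, mul_comm (shiftedFactorial f δ _ (α i + 1))]
    congr 2
    · push_cast; ring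
    · congr 1
      push_cast; ring
    · congr 1
      push_cast; ring
  · simp only [Pi.add_apply, h, ne_eq, not_false_eq_true, Pi.single_eq_of_ne, add_zero]
    congr 2 <;> push_cast <;> ring

/-- After reflecting [y]_p and [y - nδ]_p, both sides come from the two splittings of one product of
length n + p. This absorbs the ratio left over by `differenceWeight` into the weight of the special
parameter d₀. -/
theorem shiftedFactorial_div_mul (hf : ∀ x, f (-x) = -f x) (y : ℂ) (n p : ℕ)
    (h : shiftedFactorial f δ y p ≠ 0) :
    shiftedFactorial f δ (y - n * δ) p / shiftedFactorial f δ y p *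
      shiftedFactorial f δ (δ - y - p * δ) n = shiftedFactorial f δ (δ - y) n := by
  rw [div_mul_eq_mul_div, div_eq_iff h, shiftedFactorial_reflect δ hf y p,
    shiftedFactorial_reflect δ hf (y - n * δ) p, mul_left_comm, mul_assoc]
  congr 1
  have e := shiftedFactorial_mul_comm f δ (δ - y - p * δ) p n
  rw [show δ - y - p * δ + p * δ = δ - y by ring,
    show δ - y - p * δ + n * δ = δ - (y - n * δ) - p * δ by ring] at e
  rw [mul_comm, ← e, mul_comm]

/-- The value d₀ = x_i + s + pδ is exactly the one for which the surplus factors of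
`differenceWeight` and `wellPoisedWeight` cancel against the weight of d₀. What remains in front is
independent of κ, so it can be pulled out of the sum. Here d₀ keeps its value while s, d₁, d₂ move
by pδ. -/
theorem normalizedTerm_add_single (hf : ∀ x, f (-x) = -f x)
    (α κ : ι → ℕ) (hκ : κ ≤ α) (x : ι → ℂ) (s : ℂ) (c : Fin 3 → ℂ) (d₁ d₂ : ℂ) (i : ι) (p : ℕ)
    (hx : ∀ j, shiftedFactorial f δ
      (x i - ((x + Pi.single i ((p : ℂ) * δ) : ι → ℂ) j + κ j * δ)) p ≠ 0)
    (hs : shiftedFactorial f δ (x i + s + p * δ + ((∑ j, κ j : ℕ) : ℂ) * δ) p ≠ 0) :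
    normalizedTerm f δ (α + Pi.single i p) x s c ![x i + s + p * δ, d₁, d₂]
        (κ + Pi.single i p) =
      (-1) ^ p * (∏ k, shiftedFactorial f δ (x i + c k) p) *
        (shiftedFactorial f δ d₁ p * shiftedFactorial f δ d₂ p) *
      normalizedTerm f δ α (x + Pi.single i ((p : ℂ) * δ)) (s + p * δ) c
        ![x i + s + p * δ, d₁ + p * δ, d₂ + p * δ] κ := by
  have key : differenceWeight f δ (α + Pi.single i p) x (κ + Pi.single i p) *
      wellPoisedWeight f δ (α + Pi.single i p) x s (κ + Pi.single i p) *
      lowerWeight f δ (α + Pi.single i p) x s (x i + s + p * δ) (κ + Pi.single i p) =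
      (-1) ^ p * (differenceWeight f δ α (x + Pi.single i ((p : ℂ) * δ)) κ *
      wellPoisedWeight f δ α (x + Pi.single i ((p : ℂ) * δ)) (s + p * δ) κ *
      lowerWeight f δ α (x + Pi.single i ((p : ℂ) * δ)) (s + p * δ) (x i + s + p * δ) κ) := by
    have hprod : (∏ j, shiftedFactorial f δ
          (x i - ((x + Pi.single i ((p : ℂ) * δ) : ι → ℂ) j + α j * δ)) p /
        shiftedFactorial f δ (x i - ((x + Pi.single i ((p : ℂ) * δ) : ι → ℂ) j + κ j * δ)) p) *
        ∏ l, shiftedFactorial f δ (x l + ((κ + Pi.single i p : ι → ℕ) l : ℂ) * δ +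
          (δ + s - (x i + s + p * δ))) ((α + Pi.single i p : ι → ℕ) l -
            (κ + Pi.single i p : ι → ℕ) l) =
        ∏ l, shiftedFactorial f δ ((x + Pi.single i ((p : ℂ) * δ) : ι → ℂ) l + κ l * δ +
          (δ + (s + p * δ) - (x i + s + p * δ))) (α l - κ l) := by
      rw [← prod_mul_distrib]
      refine prod_congr rfl fun l _ => ?_
      rw [add_single_shift, show (α + Pi.single i p : ι → ℕ) l - (κ + Pi.single i p : ι → ℕ) l =
        α l - κ l by simp only [Pi.add_apply, Nat.add_sub_add_right]]
      have e := shiftedFactorial_div_mul hf _ (α l - κ l) p (hx l)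
      convert e using 2
      · congr 2
        rw [Nat.cast_sub (hκ l)]; ring
      · congr 1; ring
      · ring
    rw [differenceWeight_add_single, wellPoisedWeight_add_single, lowerWeight, lowerWeight,
      ← hprod, sum_add_single, shiftedFactorial_add]
    rw [mul_comm (shiftedFactorial f δ _ (∑ j, κ j)) (shiftedFactorial f δ _ p)]
    have e := inv_mul_cancel₀ hs
    linear_combination ((-1) ^ p * (∏ j, shiftedFactorial f δ
          (x i - ((x + Pi.single i ((p : ℂ) * δ) : ι → ℂ) j + α j * δ)) p /
        shiftedFactorial f δ (x i - ((x + Pi.single i ((p : ℂ) * δ) : ι → ℂ) j + κ j * δ)) p) *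
      differenceWeight f δ α (x + Pi.single i ((p : ℂ) * δ)) κ *
      wellPoisedWeight f δ α (x + Pi.single i ((p : ℂ) * δ)) (s + p * δ) κ *
      shiftedFactorial f δ (x i + s + p * δ) (∑ j, κ j) *
      ∏ l, shiftedFactorial f δ (x l + ((κ + Pi.single i p : ι → ℕ) l : ℂ) * δ +
          (δ + s - (x i + s + p * δ))) ((α + Pi.single i p : ι → ℕ) l -
            (κ + Pi.single i p : ι → ℕ) l)) * e
  simp only [normalizedTerm, Fin.prod_univ_three, Matrix.cons_val_zero, Matrix.cons_val_one,
    Matrix.cons_val] at key ⊢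
  rw [upperWeight_add_single, upperWeight_add_single, upperWeight_add_single,
    lowerWeight_add_single _ _ _ _ d₁, lowerWeight_add_single _ _ _ _ d₂]
  linear_combination (shiftedFactorial f δ (x i + c 0) p * shiftedFactorial f δ (x i + c 1) p *
    shiftedFactorial f δ (x i + c 2) p * shiftedFactorial f δ d₁ p * shiftedFactorial f δ d₂ p *
    upperWeight f δ α (x + Pi.single i ((p : ℂ) * δ)) (s + p * δ) (c 0) κ *
    upperWeight f δ α (x + Pi.single i ((p : ℂ) * δ)) (s + p * δ) (c 1) κ *
    upperWeight f δ α (x + Pi.single i ((p : ℂ) * δ)) (s + p * δ) (c 2) κ *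
    lowerWeight f δ α (x + Pi.single i ((p : ℂ) * δ)) (s + p * δ) (d₁ + p * δ) κ *
    lowerWeight f δ α (x + Pi.single i ((p : ℂ) * δ)) (s + p * δ) (d₂ + p * δ) κ) * key

/-- The genericity assumptions on `x` and `s`. -/
structure GenericBase (f : ℂ → ℂ) (δ : ℂ) (x : ι → ℂ) (s : ℂ) : Prop where
  sub : ∀ i j, i ≠ j → Avoids f δ (x i - x j)
  add : ∀ i, Avoids f δ (x i + s)

theorem GenericBase.sub_ne {ι : Type*} [DecidableEq ι] {x : ι → ℂ} {s : ℂ} (hg : GenericBase f δ x s)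
    (hδ : ∀ k : ℤ, k ≠ 0 → f ((k : ℂ) * δ) ≠ 0) (κ : ι → ℕ) (i : ι) (p : ℕ) (j : ι) :
    shiftedFactorial f δ
      (x i - ((x + Pi.single i ((p : ℂ) * δ) : ι → ℂ) j + κ j * δ)) p ≠ 0 := by
  by_cases h : j = i
  · subst h
    refine shiftedFactorial_ne_zero fun t ht => ?_
    have e := hδ (t - p - κ j) (by omega)
    convert e using 2
    simp only [Pi.add_apply, Pi.single_eq_same]
    push_cast; ring
  · refine (hg.sub i j (Ne.symm h)).shiftedFactorial_ne (-κ j) _ ?_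
    simp only [Pi.add_apply, ne_eq, h, not_false_eq_true, Pi.single_eq_of_ne]
    push_cast; ring

theorem GenericBase.add_ne {ι : Type*} {x : ι → ℂ} {s : ℂ} (hg : GenericBase f δ x s) (i : ι) (p k M : ℕ) :
    shiftedFactorial f δ (x i + s + p * δ + (M : ℂ) * δ) k ≠ 0 :=
  (hg.add i).shiftedFactorial_ne (p + M) _ (by push_cast; ring)

/-- At a zero of `[δ + s + x_i - d₀]_{α_i}` the normalised series becomes a smaller one. -/
theorem normalizedSeries_add_single (hf : IsRiemannBracket f)
    (hδ : ∀ k : ℤ, k ≠ 0 → f ((k : ℂ) * δ) ≠ 0)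
    (α : ι → ℕ) (x : ι → ℂ) (s : ℂ) (c : Fin 3 → ℂ) (d₁ d₂ : ℂ) (i : ι) (p : ℕ)
    (hg : GenericBase f δ x s) :
    normalizedSeries f δ (α + Pi.single i p) x s c ![x i + s + p * δ, d₁, d₂] =
      (-1) ^ p * (∏ k, shiftedFactorial f δ (x i + c k) p) *
        (shiftedFactorial f δ d₁ p * shiftedFactorial f δ d₂ p) *
      normalizedSeries f δ α (x + Pi.single i ((p : ℂ) * δ)) (s + p * δ) c
        ![x i + s + p * δ, d₁ + p * δ, d₂ + p * δ] := by
  have hterm := fun κ (hκ : κ ∈ Iic α) =>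
    normalizedTerm_add_single hf.odd α κ (mem_Iic.mp hκ) x s c d₁ d₂ i p
      (hg.sub_ne hδ _ i p) (hg.add_ne i p p _)
  rw [normalizedSeries, normalizedSeries, mul_sum]
  symm
  -- The shift κ ↦ κ + p e_i reaches only the indices with μ_i ≥ p, so the bijection is between
  -- nonzero terms.
  refine sum_bij_ne_zero (fun κ _ _ => κ + Pi.single i p) (fun κ hκ _ => ?_)
    (fun κ _ _ κ' _ _ h => add_right_cancel h) (fun μ hμ h0 => ?_) (fun κ hκ _ => ?_)
  · exact mem_Iic.mpr (add_le_add_left (mem_Iic.mp hκ) _)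
  · have hp : p ≤ μ i := by
      by_contra hlt
      have hlt : μ i < p := not_le.mp hlt
      refine h0 ?_
      have hz : lowerWeight f δ (α + Pi.single i p) x s (x i + s + p * δ) μ = 0 := by
        rw [lowerWeight, prod_eq_zero (mem_univ i), mul_zero]
        -- The factor with this index is [0]; it is present because μ_i < p.
        refine shiftedFactorial_eq_zero (j := p - 1 - μ i) ?_ ?_
        · simp; omega
        · rw [show ((p - 1 - μ i : ℕ) : ℂ) = p - 1 - μ i by
            rw [show p - 1 - μ i = p - (μ i + 1) by omega, Nat.cast_sub hlt]; push_cast; ring,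
            show x i + μ i * δ + (δ + s - (x i + s + p * δ)) + (p - 1 - μ i) * δ = 0 by ring,
            hf.map_zero]
      rw [normalizedTerm, Fin.prod_univ_three]
      simp [hz]
    have hle : Pi.single i p ≤ μ := by
      intro l
      by_cases h : l = i
      · subst h; simpa using hp
      · simp [h]
    have hmem : μ - Pi.single i p ∈ Iic α := by
      rw [mem_Iic, tsub_le_iff_right]
      exact mem_Iic.mp hμ
    have heq : μ - Pi.single i p + Pi.single i p = μ := tsub_add_cancel_of_le hle
    have ht := hterm _ hmem
    rw [heq] at ht
    refine ⟨μ - Pi.single i p, hmem, fun h => h0 ?_, heq⟩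
    rw [ht]
    exact h
  · exact (hterm κ hκ).symm

end Residue

/-! ### Interpolation of the normalised series -/

section Interpolation

variable {f : ℂ → ℂ} {δ : ℂ} {ι : Type*} [Fintype ι] [DecidableEq ι]

/-- The series is symmetric in the c's and in the d's. A rearrangement is encoded by equality of the
products of every φ, so that `ring` can verify it. -/
theorem normalizedSeries_congr (α : ι → ℕ) (x : ι → ℂ) (s : ℂ) {c c' d d' : Fin 3 → ℂ}
    (hc : ∀ φ : ℂ → ℂ, ∏ k, φ (c k) = ∏ k, φ (c' k))
    (hd : ∀ φ : ℂ → ℂ, ∏ k, φ (d k) = ∏ k, φ (d' k)) :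
    normalizedSeries f δ α x s c d = normalizedSeries f δ α x s c' d' := by
  refine sum_congr rfl fun μ _ => ?_
  rw [normalizedTerm, normalizedTerm, prod_mul_distrib, prod_mul_distrib,
    hc fun c => upperWeight f δ α x s c μ, hd fun d => lowerWeight f δ α x s d μ]

/-- The degree |μ| + Σ(α_i - μ_i) = |α| is the same for every μ, so the whole series has this
degree. -/
theorem lowerWeight_mul_evenTheta {ι : Type*} [Fintype ι] (hf : IsRiemannBracket f) (α : ι → ℕ) (x : ι → ℂ) (s D r : ℂ)
    {μ : ι → ℕ} (hμ : μ ≤ α) :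
    EvenTheta f D (∑ i, α i) fun z =>
      lowerWeight f δ α x s (z + r) μ * lowerWeight f δ α x s (D - z + r) μ := by
  have h := (EvenTheta.shiftedFactorial_add (D := D) hf δ r (∑ i, μ i)).mul
    (EvenTheta.prod univ fun i _ =>
      EvenTheta.shiftedFactorial_sub (D := D) hf δ (x i + μ i * δ + (δ + s - r)) (α i - μ i))
  rw [← sum_add_distrib, sum_congr rfl fun i _ => Nat.add_sub_of_le (hμ i)] at h
  convert h using 2 with z
  rw [prod_mul_distrib, lowerWeight, lowerWeight, mul_mul_mul_comm]
  congr 2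
  · exact prod_congr rfl fun i _ => congrArg (shiftedFactorial f δ · _) (by ring)
  · exact prod_congr rfl fun i _ => congrArg (shiftedFactorial f δ · _) (by ring)

theorem normalizedSeries_evenTheta (hf : IsRiemannBracket f) (α : ι → ℕ) (x : ι → ℂ)
    (s D r : ℂ) (c : Fin 3 → ℂ) (d₂ : ℂ) :
    EvenTheta f D (∑ i, α i) fun z =>
      normalizedSeries f δ α x s c ![z + r, D - z + r, d₂] := by
  refine EvenTheta.sum _ fun μ hμ => ?_
  have h := (lowerWeight_mul_evenTheta (δ := δ) hf α x s D r (mem_Iic.mp hμ)).const_mul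
    (differenceWeight f δ α x μ * wellPoisedWeight f δ α x s μ *
      (∏ k, upperWeight f δ α x s (c k) μ) * lowerWeight f δ α x s d₂ μ)
  convert h using 2 with z
  simp only [normalizedTerm, Fin.prod_univ_three, Matrix.cons_val_zero, Matrix.cons_val_one,
    Matrix.cons_val]
  ring

/-- The nodes are the |α| points x_i + s + pδ together with z₀ (the `none` of the `Option` type),
one more than the degree. The `Avoids` hypotheses make them independent. -/
theorem eq_zero_of_residues (hf : IsRiemannBracket f)
    (hδ : ∀ k : ℤ, k ≠ 0 → f ((k : ℂ) * δ) ≠ 0) {α : ι → ℕ} {x : ι → ℂ} {s D z₀ : ℂ}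
    {F : ℂ → ℂ} (hF : EvenTheta f D (∑ i, α i) F) (hg : GenericBase f δ x s)
    (hD : ∀ i j, Avoids f δ (x i + x j + 2 * s - D)) (hsub : ∀ i, Avoids f δ (x i + s - z₀))
    (hadd : ∀ i, Avoids f δ (x i + s + z₀ - D)) (h₀ : F z₀ = 0)
    (h : ∀ i p, 0 < p → p ≤ α i → F (x i + s + p * δ) = 0) (w : ℂ) : F w = 0 := by
  refine hF.eq_zero hf (κ := Option (Σ i, Fin (α i))) (by simp [Fintype.card_option])
    (fun q => q.elim z₀ fun q => x q.1 + s + ((q.2 + 1 : ℕ) : ℂ) * δ) ?_ ?_ ?_ w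
  · rintro (_ | ⟨i, j⟩)
    · exact h₀
    · exact h i (j + 1) j.val.succ_pos j.isLt
  · rintro (_ | ⟨i, j⟩) (_ | ⟨i', j'⟩) hne
    · exact absurd rfl hne
    · have := (hsub i').ne (j' + 1) (w' := x i' + s + ((j' + 1 : ℕ) : ℂ) * δ - z₀)
        (by push_cast; ring)
      rw [← neg_sub, hf.odd] at this
      exact neg_ne_zero.mp this
    · exact (hsub i).ne (j + 1) (by simp; ring)
    · by_cases hi : i = i'
      · subst hi
        have hj : (j : ℤ) - j' ≠ 0 := fun e => hne (by
          rw [show j = j' from Fin.ext (by omega)])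
        have := hδ _ hj
        convert this using 2
        simp only [Option.elim]; push_cast; ring
      · exact (hg.sub i i' hi).ne (j - j') (by simp; ring)
  · rintro (_ | ⟨i, j⟩) (_ | ⟨i', j'⟩) hne
    · exact absurd rfl hne
    · exact (hadd i').ne (j' + 1) (by simp; ring)
    · exact (hadd i).ne (j + 1) (by simp; ring)
    · exact (hD i i').ne (j + 1 + (j' + 1)) (by simp; ring)

theorem prod_shiftedFactorial_add_single (α : ι → ℕ) (x : ι → ℂ) (w : ℂ) (i : ι) (p : ℕ) :
    ∏ l, shiftedFactorial f δ (x l + w) ((α + Pi.single i p : ι → ℕ) l) =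
      shiftedFactorial f δ (x i + w) p *
        ∏ l, shiftedFactorial f δ ((x + Pi.single i ((p : ℂ) * δ) : ι → ℂ) l + w) (α l) := by
  refine prod_eq_mul_prod_of_single i _ _ _ ?_ fun l h => by simp [h]
  simp only [Pi.add_apply, Pi.single_eq_same]
  rw [add_comm (α i), shiftedFactorial_add]
  congr 2; ring

/-- The factor [0]_{|μ|} kills every term except μ = 0. -/
theorem normalizedSeries_zero (hf : IsRiemannBracket f) (α : ι → ℕ) (x : ι → ℂ) (s : ℂ)
    (c : Fin 3 → ℂ) (d₁ d₂ : ℂ) (hs : ∀ i, Avoids f δ (x i + s)) :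
    normalizedSeries f δ α x s c ![0, d₁, d₂] =
      (∏ k, shiftedFactorial f δ (δ + s - c k) (∑ i, α i)) *
        ((∏ i, shiftedFactorial f δ (x i + (δ + s - d₁)) (α i)) *
          ∏ i, shiftedFactorial f δ (x i + (δ + s - d₂)) (α i)) := by
  have hz : (0 : ι → ℕ) ∈ Iic α := mem_Iic.mpr zero_le
  rw [normalizedSeries, sum_eq_single_of_mem _ hz]
  · have h1 : wellPoisedWeight f δ α x s 0 * lowerWeight f δ α x s 0 0 = 1 := by
      rw [wellPoisedWeight, lowerWeight]
      simp only [Pi.zero_apply, sum_const_zero, shiftedFactorial_zero, one_mul]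
      rw [← prod_mul_distrib]
      refine prod_eq_one fun i _ => ?_
      have hne : shiftedFactorial f δ (x i + s) (α i + 1) ≠ 0 :=
        (hs i).shiftedFactorial_ne 0 _ (by simp)
      have e : shiftedFactorial f δ (x i + s) (α i + 1) =
          f (x i + s) * shiftedFactorial f δ (x i + (δ + s)) (α i) := by
        rw [add_comm (α i), shiftedFactorial_add]
        congr 1
        · simp [shiftedFactorial]
        · congr 1; push_cast; ring
      simp only [Nat.cast_zero, zero_mul, add_zero, sub_zero, tsub_zero]
      rw [div_mul_eq_mul_div, div_eq_one_iff_eq hne, e]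
    have h2 : differenceWeight f δ α x 0 = 1 := by
      simp [differenceWeight]
    simp only [normalizedTerm, Fin.prod_univ_three, Matrix.cons_val_zero, Matrix.cons_val_one,
      Matrix.cons_val, h2]
    have hu : ∀ c, upperWeight f δ α x s c 0 = shiftedFactorial f δ (δ + s - c) (∑ i, α i) := by
      simp [upperWeight]
    have hl : ∀ d, lowerWeight f δ α x s d 0 =
        ∏ i, shiftedFactorial f δ (x i + (δ + s - d)) (α i) := by
      simp [lowerWeight]
    rw [hu, hu, hu, hl d₁, hl d₂]
    linear_combination (shiftedFactorial f δ (δ + s - c 0) (∑ i, α i) *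
      shiftedFactorial f δ (δ + s - c 1) (∑ i, α i) *
      shiftedFactorial f δ (δ + s - c 2) (∑ i, α i) *
      ((∏ i, shiftedFactorial f δ (x i + (δ + s - d₁)) (α i)) *
          ∏ i, shiftedFactorial f δ (x i + (δ + s - d₂)) (α i))) * h1
  · intro μ _ hμ
    have hpos : 0 < ∑ i, μ i := by
      obtain ⟨i, hi⟩ := Function.ne_iff.mp hμ
      exact sum_pos' (fun _ _ => zero_le) ⟨i, mem_univ i, Nat.pos_of_ne_zero hi⟩
    have h0 : lowerWeight f δ α x s 0 μ = 0 := by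
      rw [lowerWeight, shiftedFactorial_eq_zero hpos (by simp [hf.map_zero]), zero_mul]
    simp [normalizedTerm, Fin.prod_univ_three, h0]

theorem add_single_apply {ι : Type*} [DecidableEq ι] (x : ι → ℂ) (i : ι) (p : ℕ) (l : ι) :
    (x + Pi.single i ((p : ℂ) * δ) : ι → ℂ) l =
      x l + ((Pi.single i p : ι → ℕ) l : ℂ) * δ := by
  simpa using (add_single_shift (δ := δ) x 0 i p l).symm

theorem GenericBase.add_single {ι : Type*} [DecidableEq ι] {x : ι → ℂ} {s : ℂ}
    (hg : GenericBase f δ x s) (i : ι) (p : ℕ) :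
    GenericBase f δ (x + Pi.single i ((p : ℂ) * δ)) (s + p * δ) := by
  refine ⟨fun l j h => (hg.sub l j h).shift
    ((Pi.single i p : ι → ℕ) l - (Pi.single i p : ι → ℕ) j) ?_,
    fun l => (hg.add l).shift ((Pi.single i p : ι → ℕ) l + p) ?_⟩
  · rw [add_single_apply, add_single_apply]; push_cast; ring
  · rw [add_single_apply]; push_cast; ring

end Interpolation

/-! ### The Jackson sum and the Bailey transformation of the normalised series -/

section Bailey

variable {f : ℂ → ℂ} {δ : ℂ} {ι : Type*} [Fintype ι] [DecidableEq ι]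

theorem exists_eq_add_single {ι : Type*} [DecidableEq ι] {α : ι → ℕ} {i : ι} {p : ℕ} (hp : p ≤ α i) :
    ∃ α' : ι → ℕ, α = α' + Pi.single i p :=
  ⟨α - Pi.single i p, (tsub_add_cancel_of_le fun l => by
    by_cases h : l = i
    · subst h; simpa using hp
    · simp [h]).symm⟩

theorem shiftedFactorial_reflect_of_eq (hf : ∀ x, f (-x) = -f x) {x y : ℂ} {k : ℕ}
    (h : x + y + k * δ = δ) :
    shiftedFactorial f δ x k = (-1) ^ k * shiftedFactorial f δ y k := by
  rw [shiftedFactorial_reflect δ hf, show δ - x - k * δ = y by linear_combination -h]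

/-- The Jackson sum: the normalised series with `c₂ + d₂ = δ + s` has a closed form. -/
theorem normalizedSeries_jackson (hf : IsRiemannBracket f)
    (hδ : ∀ k : ℤ, k ≠ 0 → f ((k : ℂ) * δ) ≠ 0) (n : ℕ) :
    ∀ (α : ι → ℕ) (x : ι → ℂ) (s c₀ c₁ d₀ d₁ d₂ : ℂ), ∑ i, α i = n → GenericBase f δ x s →
      (∀ i j, Avoids f δ (x i + x j + 2 * s - (d₀ + d₁))) →
      (∀ i, Avoids f δ (x i + s - (d₀ + d₁))) →
      c₀ + c₁ + d₀ + d₁ = δ + 2 * s + (n : ℂ) * δ →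
      normalizedSeries f δ α x s ![c₀, c₁, δ + s - d₂] ![d₀, d₁, d₂] =
        shiftedFactorial f δ d₂ n * (∏ l, shiftedFactorial f δ (x l + (δ + s - d₂)) (α l)) *
          ((-1) ^ n * (shiftedFactorial f δ (δ + s - c₀ - d₀) n *
            shiftedFactorial f δ (δ + s - c₀ - d₁) n) *
            ∏ l, shiftedFactorial f δ (x l + (δ + s - (d₀ + d₁))) (α l)) := by
  induction n using Nat.strong_induction_on with
  | _ n ih =>
  intro α x s c₀ c₁ d₀ d₁ d₂ hα hg hD hD' hbal
  obtain ⟨D, rfl⟩ : ∃ D, d₁ = D - d₀ := ⟨d₀ + d₁, by ring⟩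
  rw [add_sub_cancel] at hD hD' ⊢
  have hbal' : c₀ + c₁ + D = δ + 2 * s + (n : ℂ) * δ := by linear_combination hbal
  rw [← sub_eq_zero]
  -- At z = 0 the series reduces to one term, which is matched with the closed form by reflecting [δ
  -- + s - c₁]_n through the balancing condition.
  refine eq_zero_of_residues (α := α) (D := D) (z₀ := 0) (F := fun z =>
    normalizedSeries f δ α x s ![c₀, c₁, δ + s - d₂] ![z, D - z, d₂] -
      shiftedFactorial f δ d₂ n * (∏ l, shiftedFactorial f δ (x l + (δ + s - d₂)) (α l)) *
          ((-1) ^ n * (shiftedFactorial f δ (δ + s - c₀ - z) n *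
            shiftedFactorial f δ (δ + s - c₀ - (D - z)) n) *
            ∏ l, shiftedFactorial f δ (x l + (δ + s - D)) (α l)))
    hf hδ ?_ hg hD (fun i => ?_) (fun i => ?_) ?_ (fun i p hp hpi => ?_) d₀
  · have h1 := normalizedSeries_evenTheta (δ := δ) hf α x s D 0 ![c₀, c₁, δ + s - d₂] d₂
    have h2 := (EvenTheta.shiftedFactorial_sub (D := D) hf δ (δ + s - c₀) n).const_mul
      (-(shiftedFactorial f δ d₂ n * (∏ l, shiftedFactorial f δ (x l + (δ + s - d₂)) (α l)) *
          ((-1) ^ n * ∏ l, shiftedFactorial f δ (x l + (δ + s - D)) (α l))))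
    rw [← hα] at h2 ⊢
    convert h1.add h2 using 2 with z
    simp only [add_zero]
    ring
  · simpa using hg.add i
  · simpa using hD' i
  · simp only [sub_zero]
    rw [normalizedSeries_zero hf α x s _ D d₂ hg.add, hα]
    simp only [Fin.prod_univ_three, Matrix.cons_val_zero, Matrix.cons_val_one, Matrix.cons_val]
    rw [shiftedFactorial_reflect_of_eq hf.odd (x := δ + s - c₁) (y := δ + s - c₀ - D)
      (by linear_combination -hbal'), show δ + s - (δ + s - d₂) = d₂ by ring]
    ring
  · obtain ⟨α', rfl⟩ := exists_eq_add_single hpi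
    obtain ⟨k, hk⟩ : ∃ k, k = ∑ l, α' l := ⟨_, rfl⟩
    rw [sum_add_single, ← hk] at hα
    subst hα
    have hlt : k < k + p := by omega
    -- Since s and d₂ both move by pδ, the relation c₂ + d₂ = δ + s persists, with c₂ unchanged.
    have hIH := ih k hlt α' (x + Pi.single i ((p : ℂ) * δ)) (s + p * δ) c₀ c₁ (x i + s + p * δ)
      (D - (x i + s + p * δ) + p * δ) (d₂ + p * δ) hk.symm (hg.add_single i p)
      (fun l j => (hD l j).shift ((Pi.single i p : ι → ℕ) l + (Pi.single i p : ι → ℕ) j + p) (by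
        rw [add_single_apply, add_single_apply]; push_cast; ring))
      (fun l => (hD' l).shift ((Pi.single i p : ι → ℕ) l) (by
        rw [add_single_apply]; push_cast; ring))
      (by push_cast at hbal'; linear_combination hbal')
    rw [show δ + (s + p * δ) - (d₂ + p * δ) = δ + s - d₂ by ring,
      show δ + (s + p * δ) - c₀ - (D - (x i + s + p * δ) + p * δ) =
        δ + s - c₀ - (D - (x i + s + p * δ)) by ring,
      show δ + (s + p * δ) - (x i + s + p * δ + (D - (x i + s + p * δ) + p * δ)) =
        δ + s - D by ring] at hIH
    rw [normalizedSeries_add_single hf hδ α' x s _ _ _ i p hg, hIH]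
    simp only [Fin.prod_univ_three, Matrix.cons_val_zero, Matrix.cons_val_one, Matrix.cons_val]
    have e1 : shiftedFactorial f δ d₂ (k + p) =
        shiftedFactorial f δ d₂ p * shiftedFactorial f δ (d₂ + p * δ) k := by
      rw [add_comm k p, shiftedFactorial_add]
    have e3 : shiftedFactorial f δ (δ + s - c₀ - (x i + s + p * δ)) (k + p) =
        (-1) ^ p * shiftedFactorial f δ (x i + c₀) p *
          shiftedFactorial f δ (δ + (s + p * δ) - c₀ - (x i + s + p * δ)) k := by
      rw [add_comm k p, shiftedFactorial_add, shiftedFactorial_reflect_of_eq hf.odd (y := x i + c₀)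
        (by ring)]
      congr 2; ring
    have e4 : shiftedFactorial f δ (δ + s - c₀ - (D - (x i + s + p * δ))) (k + p) =
        shiftedFactorial f δ (δ + s - c₀ - (D - (x i + s + p * δ))) k *
          shiftedFactorial f δ (x i + c₁) p := by
      rw [shiftedFactorial_add]
      congr 2
      push_cast at hbal'
      linear_combination -hbal'
    have e5 : shiftedFactorial f δ (x i + (δ + s - D)) p =
        (-1) ^ p * shiftedFactorial f δ (D - (x i + s + p * δ)) p :=
      shiftedFactorial_reflect_of_eq hf.odd (by ring)
    have h1 : ((-1) ^ p * (-1) ^ p : ℂ) = 1 := by rw [← mul_pow]; simp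
    rw [e1, e3, e4, prod_shiftedFactorial_add_single, prod_shiftedFactorial_add_single, e5,
      pow_add, sub_eq_zero]
    generalize (-1 : ℂ) ^ p = ε at *
    generalize (∏ l, shiftedFactorial f δ ((x + Pi.single i ((p : ℂ) * δ) : ι → ℂ) l +
      (δ + s - D)) (α' l)) = P₁
    generalize (∏ l, shiftedFactorial f δ ((x + Pi.single i ((p : ℂ) * δ) : ι → ℂ) l +
      (δ + s - d₂)) (α' l)) = P₂
    generalize shiftedFactorial f δ (δ + (s + p * δ) - c₀ - (x i + s + p * δ)) k = a₁
    generalize shiftedFactorial f δ (δ + s - c₀ - (D - (x i + s + p * δ))) k = a₂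
    generalize shiftedFactorial f δ (x i + c₀) p = a₃
    generalize shiftedFactorial f δ (x i + c₁) p = a₄
    generalize shiftedFactorial f δ (x i + (δ + s - d₂)) p = a₅
    generalize shiftedFactorial f δ (D - (x i + s + p * δ)) p = a₆
    generalize shiftedFactorial f δ d₂ p = a₇
    generalize shiftedFactorial f δ (d₂ + p * δ) k = a₈
    linear_combination (-ε * (-1) ^ k * P₁ * P₂ * a₁ * a₂ * a₃ * a₄ * a₅ * a₆ * a₇ * a₈) * h1

/-- The genericity assumptions under which the Bailey transformation is proved by induction;
here `c = c₂`, `D = d₀ + d₁` and `e = d₂`. -/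
structure BaileyGeneric (f : ℂ → ℂ) (δ : ℂ) {ι : Type*} (x : ι → ℂ) (s c D e : ℂ) : Prop
    extends GenericBase f δ x s where
  upper : ∀ i, Avoids f δ (x i + c)
  pair : ∀ i j, Avoids f δ (x i + x j + 2 * s - D)
  base : ∀ i, Avoids f δ (x i + 2 * s - c - D)
  pair' : ∀ i j, Avoids f δ (x i + x j + 3 * s - c - D - e)
  base' : ∀ i, Avoids f δ (x i + 2 * s - c - D - e)

/-- Genericity survives the passage to a smaller α because every linear form involved moves by an
integer multiple of δ. -/
theorem BaileyGeneric.add_single {ι : Type*} [DecidableEq ι] {x : ι → ℂ} {s c D e : ℂ}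
    (h : BaileyGeneric f δ x s c D e) (i : ι) (p : ℕ) :
    BaileyGeneric f δ (x + Pi.single i ((p : ℂ) * δ)) (s + p * δ) c (D + p * δ) (e + p * δ) where
  toGenericBase := h.toGenericBase.add_single i p
  upper l := (h.upper l).shift ((Pi.single i p : ι → ℕ) l) (by
    rw [add_single_apply]; push_cast; ring)
  pair l j := (h.pair l j).shift ((Pi.single i p : ι → ℕ) l + (Pi.single i p : ι → ℕ) j + p) (by
    rw [add_single_apply, add_single_apply]; push_cast; ring)
  base l := (h.base l).shift ((Pi.single i p : ι → ℕ) l + p) (by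
    rw [add_single_apply]; push_cast; ring)
  pair' l j := (h.pair' l j).shift ((Pi.single i p : ι → ℕ) l + (Pi.single i p : ι → ℕ) j + p)
    (by rw [add_single_apply, add_single_apply]; push_cast; ring)
  base' l := (h.base' l).shift ((Pi.single i p : ι → ℕ) l) (by
    rw [add_single_apply]; push_cast; ring)

/-- The Bailey transformation of the normalised series, at generic parameters. -/
theorem normalizedSeries_bailey (hf : IsRiemannBracket f)
    (hδ : ∀ k : ℤ, k ≠ 0 → f ((k : ℂ) * δ) ≠ 0) (n : ℕ) :
    ∀ (α : ι → ℕ) (x : ι → ℂ) (s c₀ c₁ c₂ d₀ d₁ d₂ r : ℂ), ∑ i, α i = n →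
      BaileyGeneric f δ x s c₂ (d₀ + d₁) d₂ → r = δ + s - c₂ - d₀ - d₁ →
      c₀ + c₁ + c₂ + d₀ + d₁ + d₂ = 2 * δ + 3 * s + (n : ℂ) * δ →
      normalizedSeries f δ α x s ![c₀, c₁, c₂] ![d₀, d₁, d₂] =
        normalizedSeries f δ α x (s + r) ![c₀, c₁, c₂ + r] ![d₀ + r, d₁ + r, d₂] := by
  induction n using Nat.strong_induction_on with
  | _ n ih =>
  intro α x s c₀ c₁ c₂ d₀ d₁ d₂ r hα hg hr hbal
  obtain ⟨D, rfl⟩ : ∃ D, d₁ = D - d₀ := ⟨d₀ + d₁, by ring⟩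
  rw [add_sub_cancel] at hg
  have hbal' : c₀ + c₁ + c₂ + D + d₂ = 2 * δ + 3 * s + (n : ℂ) * δ := by
    linear_combination hbal
  have hr' : r = δ + s - c₂ - D := by linear_combination hr
  clear hr hbal
  have hgr : GenericBase f δ x (s + r) :=
    ⟨hg.sub, fun i => (hg.base i).shift 1 (by rw [hr']; push_cast; ring)⟩
  rw [← sub_eq_zero]
  -- At this z₀ the left series has c₂ + d₀ = δ + s, so it is a Jackson sum, while on the right d₁ +
  -- r = D - z₀ + r = 0 leaves one term. The conditions `pair'` and `base'` are those of that
  -- Jackson sum; `upper` and `base` separate z₀ from the other nodes.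
  refine eq_zero_of_residues (α := α) (D := D) (z₀ := δ + s - c₂) (F := fun z =>
    normalizedSeries f δ α x s ![c₀, c₁, c₂] ![z, D - z, d₂] -
      normalizedSeries f δ α x (s + r) ![c₀, c₁, c₂ + r] ![z + r, D - z + r, d₂])
    hf hδ ?_ hg.toGenericBase hg.pair (fun i => ?_) (fun i => ?_) ?_ (fun i p hp hpi => ?_) d₀
  · have h1 := normalizedSeries_evenTheta (δ := δ) hf α x s D 0 ![c₀, c₁, c₂] d₂
    have h2 := (normalizedSeries_evenTheta (δ := δ) hf α x (s + r) D r
      ![c₀, c₁, c₂ + r] d₂).const_mul (-1)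
    convert h1.add h2 using 2 with z
    simp only [add_zero]
    ring
  · exact (hg.upper i).shift (-1) (by push_cast; ring)
  · exact (hg.base i).shift 1 (by push_cast; ring)
  · have hJ := normalizedSeries_jackson hf hδ n α x s c₀ c₁ (D - (δ + s - c₂)) d₂ (δ + s - c₂)
      hα hg.toGenericBase
      (fun i j => (hg.pair' i j).shift 1 (by push_cast; ring))
      (fun i => (hg.base' i).shift 1 (by push_cast; ring))
      (by linear_combination hbal')
    have hZ := normalizedSeries_zero hf α x (s + r) ![c₀, c₁, c₂ + r] (δ + s - c₂ + r) d₂ hgr.add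
    rw [normalizedSeries_congr (d' := ![D - (δ + s - c₂), d₂, δ + s - c₂])
      (c' := ![c₀, c₁, δ + s - (δ + s - c₂)]) α x s (fun φ => by rw [sub_sub_cancel])
      (fun φ => by
        simp only [Fin.prod_univ_three, Matrix.cons_val_zero, Matrix.cons_val_one,
          Matrix.cons_val]
        ring), hJ,
      show D - (δ + s - c₂) + r = 0 by rw [hr']; ring,
      normalizedSeries_congr (d' := ![0, δ + s - c₂ + r, d₂])
      (c' := ![c₀, c₁, c₂ + r]) α x (s + r) (fun φ => rfl)
      (fun φ => by
        simp only [Fin.prod_univ_three, Matrix.cons_val_zero, Matrix.cons_val_one,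
          Matrix.cons_val]
        ring), hZ, hα]
    simp only [Fin.prod_univ_three, Matrix.cons_val_zero, Matrix.cons_val_one, Matrix.cons_val]
    rw [shiftedFactorial_reflect_of_eq hf.odd (x := δ + (s + r) - c₁) (y := δ + s - c₀ - d₂)
      (by rw [hr']; linear_combination -hbal'),
      show δ + (s + r) - c₀ = δ + s - c₀ - (D - (δ + s - c₂)) by rw [hr']; ring,
      show δ + (s + r) - (c₂ + r) = δ + s - c₂ by ring,
      show δ + (s + r) - (δ + s - c₂ + r) = δ + s - (δ + s - c₂) by ring,
      show δ + (s + r) - d₂ = δ + s - (D - (δ + s - c₂) + d₂) by rw [hr']; ring]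
    ring
  · obtain ⟨α', rfl⟩ := exists_eq_add_single hpi
    obtain ⟨k, hk⟩ : ∃ k, k = ∑ l, α' l := ⟨_, rfl⟩
    rw [sum_add_single, ← hk] at hα
    subst hα
    have hlt : k < k + p := by omega
    -- The shift r is unchanged, because s and d₀ + d₁ both move by pδ. Hence one instance of the
    -- induction hypothesis relates the reduced forms of both sides.
    have hIH := ih k hlt α' (x + Pi.single i ((p : ℂ) * δ)) (s + p * δ) c₀ c₁ c₂
      (x i + s + p * δ) (D - (x i + s + p * δ) + p * δ) (d₂ + p * δ) r hk.symm
      (by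
        rw [show x i + s + p * δ + (D - (x i + s + p * δ) + p * δ) = D + p * δ by ring]
        exact hg.add_single i p)
      (by rw [hr']; ring) (by push_cast at hbal'; linear_combination hbal')
    rw [show s + p * δ + r = s + r + p * δ by ring,
      show x i + s + p * δ + r = x i + (s + r) + p * δ by ring,
      show D - (x i + s + p * δ) + p * δ + r = D - (x i + s + p * δ) + r + p * δ by ring] at hIH
    rw [show x i + s + p * δ + r = x i + (s + r) + p * δ by ring,
      normalizedSeries_add_single hf hδ α' x s _ _ _ i p hg.toGenericBase,
      normalizedSeries_add_single hf hδ α' x (s + r) _ _ _ i p hgr, ← hIH]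
    simp only [Fin.prod_univ_three, Matrix.cons_val_zero, Matrix.cons_val_one, Matrix.cons_val]
    -- The transformation exchanges the factors of the two prefactors that come from c₂ and d₁, each
    -- up to the sign (-1)^p.
    rw [shiftedFactorial_reflect_of_eq hf.odd (x := x i + (c₂ + r)) (y := D - (x i + s + p * δ))
      (by rw [hr']; ring),
      shiftedFactorial_reflect_of_eq hf.odd (x := D - (x i + s + p * δ) + r) (y := x i + c₂)
      (by rw [hr']; ring)]
    have h1 : ((-1) ^ p * (-1) ^ p : ℂ) = 1 := by rw [← mul_pow]; simp
    generalize (-1 : ℂ) ^ p = ε at *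
    generalize normalizedSeries f δ α' _ _ _ _ = N
    generalize shiftedFactorial f δ (D - (x i + s + p * δ)) p = a₁
    generalize shiftedFactorial f δ (x i + c₀) p = a₂
    generalize shiftedFactorial f δ (x i + c₁) p = a₃
    generalize shiftedFactorial f δ (x i + c₂) p = a₄
    generalize shiftedFactorial f δ d₂ p = a₅
    linear_combination (-ε * N * a₁ * a₂ * a₃ * a₄ * a₅) * h1

end Bailey

/-! ### Reversal of the normalised series -/

section Reversal

variable {f : ℂ → ℂ} {δ : ℂ} {ι : Type*} [Fintype ι] [DecidableEq ι]

/-- After the indices i and j are interchanged, the factors agree one by one: they express the two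
splittings of [x_i - x_j - α_jδ] of length μ_i + α_j - μ_j. -/
theorem differenceWeight_reverse {ι : Type*} [Fintype ι]
    {α μ : ι → ℕ} (hμ : μ ≤ α) {x x' : ι → ℂ} {w : ℂ}
    (hx' : ∀ i, x' i = w - x i - α i * δ)
    (hne : ∀ i j, shiftedFactorial f δ (x i - (x j + μ j * δ)) (μ i) ≠ 0)
    (hne' : ∀ i j, shiftedFactorial f δ (x' i - (x' j + ((α j - μ j : ℕ) : ℂ) * δ)) (α i - μ i) ≠ 0) :
    differenceWeight f δ α x' (α - μ) = (-1) ^ (∑ i, α i) * differenceWeight f δ α x μ := by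
  have hsum : ∑ i, (α - μ) i + ∑ i, μ i = ∑ i, α i := by
    rw [← sum_add_distrib]
    exact sum_congr rfl fun i _ => Nat.sub_add_cancel (hμ i)
  have hsign : ((-1) ^ (∑ i, (α - μ) i) : ℂ) = (-1) ^ (∑ i, α i) * (-1) ^ (∑ i, μ i) := by
    rw [← hsum, pow_add, mul_assoc, ← mul_pow]; simp
  rw [differenceWeight, differenceWeight, hsign, mul_assoc]
  congr 2
  refine prod_comm.trans ?_
  refine prod_congr rfl fun i _ => prod_congr rfl fun j _ => ?_
  have h1 := hne i j
  have h2 := hne' j i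
  simp only [Pi.sub_apply]
  rw [div_eq_div_iff h2 h1]
  have hj : ((α j - μ j : ℕ) : ℂ) = α j - μ j := Nat.cast_sub (hμ j)
  have hi : ((α i - μ i : ℕ) : ℂ) = α i - μ i := Nat.cast_sub (hμ i)
  have e := shiftedFactorial_mul_comm f δ (x i - (x j + α j * δ)) (μ i) (α j - μ j)
  rw [hx', hx', hi, show w - x j - α j * δ - (w - x i - α i * δ + α i * δ) =
      x i - (x j + α j * δ) by ring,
    show w - x j - α j * δ - (w - x i - α i * δ + (α i - μ i) * δ) =
      x i - (x j + α j * δ) + μ i * δ by ring,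
    show x i - (x j + μ j * δ) = x i - (x j + α j * δ) + ((α j - μ j : ℕ) : ℂ) * δ by
      rw [hj]; ring, ← e]

/-- Reversing the order of summation exchanges the roles of `c` and `d`. -/
theorem normalizedSeries_reverse (hf : IsRiemannBracket f)
    (hδ : ∀ k : ℤ, k ≠ 0 → f ((k : ℂ) * δ) ≠ 0) (α : ι → ℕ) (x : ι → ℂ) (s : ℂ)
    (c d : Fin 3 → ℂ) (hx : ∀ i j, i ≠ j → Avoids f δ (x i - x j)) {K : ℂ}
    (hK : K = ((∑ i, α i : ℕ) : ℂ)) :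
    normalizedSeries f δ α (fun i => K * δ - x i - α i * δ) (-(2 * K * δ) - s)
        (fun k => d k - s - K * δ) (fun k => c k - s - K * δ) =
      normalizedSeries f δ α x s c d := by
  have hnz : ∀ (y : ι → ℂ), (∀ i j, i ≠ j → Avoids f δ (y i - y j)) → ∀ (ν : ι → ℕ) i j,
      shiftedFactorial f δ (y i - (y j + ν j * δ)) (ν i) ≠ 0 := by
    intro y hy ν i j
    by_cases h : i = j
    · subst h
      refine shiftedFactorial_ne_zero fun t ht => ?_
      have e := hδ (t - ν i) (by omega)
      convert e using 2
      push_cast; ring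
    · exact (hy i j h).shiftedFactorial_ne (-ν j) _ (by push_cast; ring)
  rw [normalizedSeries, normalizedSeries]
  symm
  refine sum_bij' (fun μ _ => α - μ) (fun μ _ => α - μ)
    (fun μ _ => mem_Iic.mpr tsub_le_self) (fun μ _ => mem_Iic.mpr tsub_le_self)
    (fun μ hμ => tsub_tsub_cancel_of_le (mem_Iic.mp hμ))
    (fun μ hμ => tsub_tsub_cancel_of_le (mem_Iic.mp hμ)) fun μ hμ => ?_
  have hμ : μ ≤ α := mem_Iic.mp hμ
  have hle : ∑ i, μ i ≤ ∑ i, α i := sum_le_sum fun i _ => hμ i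
  have hsum : ∑ i, (α - μ) i = ∑ i, α i - ∑ i, μ i := by
    simp only [Pi.sub_apply]
    exact sum_tsub_distrib _ fun i _ => hμ i
  have hM : ((∑ i, α i - ∑ i, μ i : ℕ) : ℂ) = K - ((∑ i, μ i : ℕ) : ℂ) := by
    rw [hK, Nat.cast_sub hle]
  have hsub : ∀ i, (((α - μ) i : ℕ) : ℂ) = α i - μ i := fun i => Nat.cast_sub (hμ i)
  have hsub' : ∀ i, α i - (α - μ) i = μ i := fun i => Nat.sub_sub_self (hμ i)
  have hD := differenceWeight_reverse (f := f) hμ (x := x)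
    (x' := fun i => K * δ - x i - α i * δ) (w := K * δ) (fun i => rfl) (hnz x hx μ) (fun i j => by
      have := hnz (fun i => K * δ - x i - α i * δ) (fun i j h =>
        (hx j i h.symm).shift (α j - α i) (by push_cast; ring)) (α - μ) i j
      exact this)
  have hW : wellPoisedWeight f δ α (fun i => K * δ - x i - α i * δ) (-(2 * K * δ) - s) (α - μ) =
      (-1) ^ (∑ i, α i) * wellPoisedWeight f δ α x s μ := by
    rw [wellPoisedWeight, wellPoisedWeight, ← prod_pow_eq_pow_sum, ← prod_mul_distrib]
    refine prod_congr rfl fun i _ => ?_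
    rw [shiftedFactorial_reflect_of_eq hf.odd (y := x i + s + ((∑ j, μ j : ℕ) : ℂ) * δ)
      (by rw [hsum, hM]; push_cast; ring), Nat.cast_add, hsub, hsum, hM,
      show K * δ - x i - α i * δ + (-(2 * K * δ) - s) +
        (K - ((∑ j, μ j : ℕ) : ℂ) + (α i - μ i)) * δ =
        -(x i + s + (((∑ j, μ j) + μ i : ℕ) : ℂ) * δ) by push_cast; ring, hf.odd, pow_succ,
      mul_neg_one, neg_mul, neg_div_neg_eq, div_mul_eq_div_div_swap, div_eq_mul_inv _ ((-1) ^ α i),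
      ← inv_pow, inv_neg_one, mul_comm]
  have hC : ∀ c, lowerWeight f δ α (fun i => K * δ - x i - α i * δ) (-(2 * K * δ) - s)
      (c - s - K * δ) (α - μ) = (-1) ^ (∑ i, α i) * upperWeight f δ α x s c μ := by
    intro c
    have hpow : ((-1) ^ (∑ i, α i) : ℂ) = (-1) ^ (∑ i, α i - ∑ i, μ i) * ∏ i, (-1) ^ μ i := by
      rw [prod_pow_eq_pow_sum, ← pow_add, Nat.sub_add_cancel hle]
    rw [lowerWeight, upperWeight, hpow, mul_mul_mul_comm, ← prod_mul_distrib, hsum]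
    congr 1
    · exact shiftedFactorial_reflect_of_eq hf.odd (by rw [hM]; ring)
    · refine prod_congr rfl fun i _ => ?_
      rw [hsub']
      exact shiftedFactorial_reflect_of_eq hf.odd (by rw [hsub]; ring)
  have hU : ∀ d, upperWeight f δ α (fun i => K * δ - x i - α i * δ) (-(2 * K * δ) - s)
      (d - s - K * δ) (α - μ) = (-1) ^ (∑ i, α i) * lowerWeight f δ α x s d μ := by
    intro d
    have hpow : ((-1) ^ (∑ i, α i) : ℂ) = (-1) ^ (∑ i, μ i) * ∏ i, (-1) ^ (α i - μ i) := by
      rw [prod_pow_eq_pow_sum, ← pow_add, sum_tsub_distrib _ (fun i _ => hμ i),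
        Nat.add_sub_cancel' hle]
    rw [lowerWeight, upperWeight, hpow, mul_mul_mul_comm, ← prod_mul_distrib, hsum,
      Nat.sub_sub_self hle]
    congr 1
    · exact shiftedFactorial_reflect_of_eq hf.odd (by rw [hM]; ring)
    · refine prod_congr rfl fun i _ => ?_
      exact shiftedFactorial_reflect_of_eq hf.odd (by
        rw [show (((α - μ) i : ℕ) : ℂ) = α i - μ i from hsub i]; ring)
  have hsq : ((-1) ^ (∑ i, α i) * (-1) ^ (∑ i, α i) : ℂ) = 1 := by rw [← mul_pow]; simp
  simp only [normalizedTerm, hD, hW, hC, hU, Fin.prod_univ_three]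
  generalize ((-1) ^ (∑ i, α i) : ℂ) = ε at *
  generalize differenceWeight f δ α x μ = w₁
  generalize wellPoisedWeight f δ α x s μ = w₂
  generalize upperWeight f δ α x s (c 0) μ = a₁
  generalize upperWeight f δ α x s (c 1) μ = a₂
  generalize upperWeight f δ α x s (c 2) μ = a₃
  generalize lowerWeight f δ α x s (d 0) μ = b₁
  generalize lowerWeight f δ α x s (d 1) μ = b₂
  generalize lowerWeight f δ α x s (d 2) μ = b₃
  -- The sign (-1)^{|α|} occurs eight times: once from each of the first two weights and once from
  -- each of the six parameters.
  linear_combination (-(w₁ * w₂ * a₁ * a₂ * a₃ * b₁ * b₂ * b₃) *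
    ((ε * ε) ^ 3 + (ε * ε) ^ 2 + ε * ε + 1)) * hsq

/-- The normalised form of the transformation that reverses `x`, at generic parameters. -/
theorem normalizedSeries_reversed_bailey (hf : IsRiemannBracket f)
    (hδ : ∀ k : ℤ, k ≠ 0 → f ((k : ℂ) * δ) ≠ 0) (α : ι → ℕ) (x : ι → ℂ)
    (s c₀ c₁ c₂ d₀ d₁ d₂ r₂ r₁ r₀ K : ℂ) (hK : K = ((∑ i, α i : ℕ) : ℂ))
    (hr₂ : r₂ = δ + s - c₂ - d₀ - d₁) (hr₁ : r₁ = δ + s - c₁ - d₀ - d₂ )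
    (hr₀ : r₀ = δ + s - c₀ - d₁ - d₂)
    (h₂ : BaileyGeneric f δ x s c₂ (d₀ + d₁) d₂)
    (h₁ : BaileyGeneric f δ x (s + r₂) c₁ (d₀ + r₂ + d₂) (d₁ + r₂))
    (h₀ : BaileyGeneric f δ x (s + r₂ + r₁) c₀ (d₁ + r₂ + (d₂ + r₁)) (d₀ + r₂ + r₁))
    (hbal : c₀ + c₁ + c₂ + d₀ + d₁ + d₂ = 2 * δ + 3 * s + K * δ) :
    normalizedSeries f δ α (fun i => K * δ - x i - α i * δ) (δ + 2 * s - c₀ - c₁ - c₂)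
        ![δ + s - c₁ - c₂, δ + s - c₀ - c₂, δ + s - c₀ - c₁] ![d₀, d₁, d₂] =
      normalizedSeries f δ α x s ![c₀, c₁, c₂] ![d₀, d₁, d₂] := by
  subst hK
  set K : ℂ := ((∑ i, α i : ℕ) : ℂ) with hK
  -- Each step shifts s, its distinguished c_k and two of the d's. In total c_k gains r_k, while d_k
  -- gains the two r's with index other than k.
  have e₂ := normalizedSeries_bailey hf hδ _ α x s c₀ c₁ c₂ d₀ d₁ d₂ r₂ rfl h₂ hr₂ hbal
  have e₁ := normalizedSeries_bailey hf hδ _ α x (s + r₂) c₀ (c₂ + r₂) c₁ (d₀ + r₂) d₂ (d₁ + r₂)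
    r₁ rfl h₁ (by rw [hr₁]; ring) (by linear_combination hbal)
  have e₀ := normalizedSeries_bailey hf hδ _ α x (s + r₂ + r₁) (c₁ + r₁) (c₂ + r₂) c₀ (d₁ + r₂)
    (d₂ + r₁) (d₀ + r₂ + r₁) r₀ rfl h₀ (by rw [hr₀]; ring) (by linear_combination hbal)
  have swap : ∀ s {a b c d e g a' b' c' d' e' g' : ℂ},
      (∀ φ : ℂ → ℂ, φ a * φ b * φ c = φ a' * φ b' * φ c') →
      (∀ φ : ℂ → ℂ, φ d * φ e * φ g = φ d' * φ e' * φ g') →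
      normalizedSeries f δ α x s ![a, b, c] ![d, e, g] =
        normalizedSeries f δ α x s ![a', b', c'] ![d', e', g'] := by
    intro s a b c d e g a' b' c' d' e' g' h h'
    refine normalizedSeries_congr α x s (fun φ => ?_) (fun φ => ?_)
    · simpa [Fin.prod_univ_three] using h φ
    · simpa [Fin.prod_univ_three] using h' φ
  rw [e₂, swap (s + r₂) (a' := c₀) (b' := c₂ + r₂) (c' := c₁) (d' := d₀ + r₂) (e' := d₂)
      (g' := d₁ + r₂) (fun φ => by ring) (fun φ => by ring), e₁,
    swap (s + r₂ + r₁) (a' := c₁ + r₁) (b' := c₂ + r₂) (c' := c₀) (d' := d₁ + r₂)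
      (e' := d₂ + r₁) (g' := d₀ + r₂ + r₁) (fun φ => by ring) (fun φ => by ring), e₀,
    ← normalizedSeries_reverse hf hδ α x _ _ _ h₂.sub hK]
  -- Reversal replaces s by -2|α|δ - s; the balancing condition turns this into the s of (II).
  have hs : -(2 * K * δ) - (s + r₂ + r₁ + r₀) = δ + 2 * s - c₀ - c₁ - c₂ := by
    rw [hr₂, hr₁, hr₀]; linear_combination 2 * hbal
  rw [hs]
  refine normalizedSeries_congr α _ _ (fun φ => ?_) (fun φ => ?_)
  · simp only [Fin.prod_univ_three, Matrix.cons_val_zero, Matrix.cons_val_one, Matrix.cons_val]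
    rw [show d₁ + r₂ + r₀ - (s + r₂ + r₁ + r₀) - K * δ = δ + s - c₀ - c₂ by
        rw [hr₁]; linear_combination hbal,
      show d₂ + r₁ + r₀ - (s + r₂ + r₁ + r₀) - K * δ = δ + s - c₀ - c₁ by
        rw [hr₂]; linear_combination hbal,
      show d₀ + r₂ + r₁ - (s + r₂ + r₁ + r₀) - K * δ = δ + s - c₁ - c₂ by
        rw [hr₀]; linear_combination hbal]
    ring
  · simp only [Fin.prod_univ_three, Matrix.cons_val_zero, Matrix.cons_val_one, Matrix.cons_val]
    rw [show c₁ + r₁ - (s + r₂ + r₁ + r₀) - K * δ = d₁ by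
        rw [hr₂, hr₁, hr₀]; linear_combination hbal,
      show c₂ + r₂ - (s + r₂ + r₁ + r₀) - K * δ = d₂ by
        rw [hr₂, hr₁, hr₀]; linear_combination hbal,
      show c₀ + r₀ - (s + r₂ + r₁ + r₀) - K * δ = d₀ by
        rw [hr₂, hr₁, hr₀]; linear_combination hbal]
    ring

end Reversal

/-! ### From the normalised series to `vwpSeries` -/

section Conversion

variable {f : ℂ → ℂ} {δ : ℂ} {m : ℕ}

theorem shiftedFactorial_one (x : ℂ) : shiftedFactorial f δ x 1 = f x := by
  simp [shiftedFactorial]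

/-- After reflection both sides express the two splittings of [y - bδ]_{a+b+1}. This combines the
entries (i, j) and (j, i) of the double product with one factor of Δ(x + μδ)/Δ(x). -/
theorem mul_shiftedFactorial_pair (hf : ∀ x, f (-x) = -f x) (y : ℂ) (a b : ℕ) :
    f (y + (a - b) * δ) * (shiftedFactorial f δ (y - b * δ) a *
        shiftedFactorial f δ (-y - a * δ) b) =
      f y * (shiftedFactorial f δ (y + δ) a * shiftedFactorial f δ (-y + δ) b) := by
  rw [shiftedFactorial_reflect_of_eq hf (x := -y - a * δ) (y := y + (a - b) * δ + δ) (by ring),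
    shiftedFactorial_reflect_of_eq hf (x := -y + δ) (y := y - b * δ) (by ring)]
  have e₁ := shiftedFactorial_add f δ (y - b * δ) a (1 + b)
  have e₂ := shiftedFactorial_add f δ (y - b * δ) b (1 + a)
  rw [show b + (1 + a) = a + (1 + b) by ring, e₁] at e₂
  rw [shiftedFactorial_add, shiftedFactorial_add, shiftedFactorial_one, shiftedFactorial_one,
    show y - b * δ + a * δ = y + (a - b) * δ by ring, show y - b * δ + b * δ = y by ring,
    Nat.cast_one, one_mul] at e₂
  linear_combination (-1) ^ b * e₂

theorem prod_prod_eq_diag_mul (F : Fin m → Fin m → ℂ) :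
    ∏ i, ∏ j, F i j = (∏ i, F i i) * ∏ i, ∏ j ∈ Ioi i, F i j * F j i := by
  have h := prod_prod_Ioi_mul_eq_prod_prod_off_diag fun i j => F j i
  rw [h, prod_congr rfl fun i _ => Fintype.prod_eq_mul_prod_compl i (F i), prod_mul_distrib]

theorem differenceProduct_add_mul (hf : ∀ x, f (-x) = -f x) (x : Fin m → ℂ) (μ : Fin m → ℕ) :
    differenceProduct f (fun i => x i + μ i * δ) *
        ∏ i, ∏ j, shiftedFactorial f δ (x i - (x j + μ j * δ)) (μ i) =
      (-1) ^ (∑ i, μ i) * (differenceProduct f x *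
        ∏ i, ∏ j, shiftedFactorial f δ (x i - x j + δ) (μ i)) := by
  have hdiag : ∏ i, shiftedFactorial f δ (x i - (x i + μ i * δ)) (μ i) =
      (-1) ^ (∑ i, μ i) * ∏ i, shiftedFactorial f δ (x i - x i + δ) (μ i) := by
    rw [← prod_pow_eq_pow_sum, ← prod_mul_distrib]
    exact prod_congr rfl fun i _ => shiftedFactorial_reflect_of_eq hf (by ring)
  have hoff : differenceProduct f (fun i => x i + μ i * δ) *
      ∏ i, ∏ j ∈ Ioi i, shiftedFactorial f δ (x i - (x j + μ j * δ)) (μ i) *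
        shiftedFactorial f δ (x j - (x i + μ i * δ)) (μ j) =
      differenceProduct f x * ∏ i, ∏ j ∈ Ioi i, shiftedFactorial f δ (x i - x j + δ) (μ i) *
        shiftedFactorial f δ (x j - x i + δ) (μ j) := by
    simp only [differenceProduct, ← prod_mul_distrib]
    refine prod_congr rfl fun i _ => prod_congr rfl fun j _ => ?_
    have e := mul_shiftedFactorial_pair (δ := δ) hf (x i - x j) (μ i) (μ j)
    convert e using 4 <;> ring
  rw [prod_prod_eq_diag_mul, prod_prod_eq_diag_mul, hdiag]
  linear_combination ((-1) ^ (∑ i, μ i) * ∏ i, shiftedFactorial f δ (x i - x i + δ) (μ i)) * hoff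

theorem differenceWeight_eq (hf : ∀ x, f (-x) = -f x) {α : Fin m → ℕ} {a x : Fin m → ℂ}
    (ha : ∀ i, a i = -(α i : ℂ) * δ) {μ : Fin m → ℕ} (hΔ : differenceProduct f x ≠ 0)
    (hx : ∀ i j, shiftedFactorial f δ (x i - x j + δ) (μ i) ≠ 0) :
    differenceWeight f δ α x μ =
      differenceProduct f (fun i => x i + (μ i : ℂ) * δ) / differenceProduct f x *
        ∏ j, ∏ i, shiftedFactorial f δ (x i - x j + a j) (μ i) /
          shiftedFactorial f δ (x i - x j + δ) (μ i) := by
  have h := differenceProduct_add_mul (δ := δ) hf x μ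
  have hQ : ∏ i, ∏ j, shiftedFactorial f δ (x i - x j + δ) (μ i) ≠ 0 :=
    prod_ne_zero_iff.mpr fun i _ => prod_ne_zero_iff.mpr fun j _ => hx i j
  -- The normalised denominators do not occur in `VwpRegular`; the product identity shows that they
  -- are nonzero.
  have hP : ∏ i, ∏ j, shiftedFactorial f δ (x i - (x j + μ j * δ)) (μ i) ≠ 0 := by
    refine right_ne_zero_of_mul (a := differenceProduct f (fun i => x i + μ i * δ)) ?_
    rw [h]
    exact mul_ne_zero (pow_ne_zero _ (by simp)) (mul_ne_zero hΔ hQ)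
  have hnum : ∀ i j, shiftedFactorial f δ (x i - (x j + α j * δ)) (μ i) =
      shiftedFactorial f δ (x i - x j + a j) (μ i) := fun i j => by
    rw [ha]; congr 1; ring
  rw [differenceWeight, prod_comm (s := univ) (t := univ) (f := fun j i =>
    shiftedFactorial f δ (x i - x j + a j) (μ i) / shiftedFactorial f δ (x i - x j + δ) (μ i))]
  simp only [prod_div_distrib, hnum]
  rw [div_mul_div_comm, mul_div_assoc', div_eq_div_iff hP (mul_ne_zero hΔ hQ)]
  linear_combination -(∏ i, ∏ j, shiftedFactorial f δ (x i - x j + a j) (μ i)) * h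

/-- The factor by which the normalised series differs from `vwpSeries`, apart from
`poleFactor`. -/
noncomputable def normFactor (f : ℂ → ℂ) (δ : ℂ) (α : Fin m → ℕ) (x : Fin m → ℂ) (s : ℂ)
    (c d : Fin 3 → ℂ) : ℂ :=
  (∏ k, shiftedFactorial f δ (δ + s - c k) (∑ i, α i)) *
    ∏ k, ∏ i, shiftedFactorial f δ (δ + s + x i - d k) (α i)

/-- The product `∏_i [δ + s + x_i]_{α_i}`. -/
noncomputable def poleFactor (f : ℂ → ℂ) (δ : ℂ) (α : Fin m → ℕ) (x : Fin m → ℂ) (s : ℂ) : ℂ :=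
  ∏ i, shiftedFactorial f δ (δ + s + x i) (α i)

/-- The comparison splits into three independent parts: the differences of x (`hA`), the very
well-poised factors together with `poleFactor` (`hB`), and each pair c_k, d_k (`hC`). -/
theorem normalizedTerm_mul_poleFactor (hf : ∀ x, f (-x) = -f x) {α : Fin m → ℕ}
    {a x : Fin m → ℂ} {s : ℂ} {c d : Fin 3 → ℂ} (ha : ∀ i, a i = -(α i : ℂ) * δ)
    (hreg : VwpRegular f δ a x s c d α) (hs : ∀ i, shiftedFactorial f δ (δ + s + x i) (α i) ≠ 0)
    {μ : Fin m → ℕ} (hμ : μ ≤ α) :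
    normalizedTerm f δ α x s c d μ * poleFactor f δ α x s =
      normFactor f δ α x s c d * vwpTerm f δ a x s c d μ := by
  have hle : ∑ i, μ i ≤ ∑ i, α i := sum_le_sum fun i _ => hμ i
  have hB : wellPoisedWeight f δ α x s μ * poleFactor f δ α x s =
      (∏ i, f (x i + s + (((∑ j, μ j) + μ i : ℕ) : ℂ) * δ) / f (x i + s)) *
        ∏ j, shiftedFactorial f δ (s + x j) (∑ l, μ l) /
          shiftedFactorial f δ (δ + s + x j - a j) (∑ l, μ l) := by
    rw [wellPoisedWeight, poleFactor, ← prod_mul_distrib, ← prod_mul_distrib]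
    refine prod_congr rfl fun i _ => ?_
    have e₁ := shiftedFactorial_add f δ (x i + s) (∑ l, μ l) (α i + 1)
    have e₂ := shiftedFactorial_add f δ (x i + s) (1 + α i) (∑ l, μ l)
    rw [show 1 + α i + ∑ l, μ l = (∑ l, μ l) + (α i + 1) by ring, e₁,
      shiftedFactorial_add f δ (x i + s) 1, shiftedFactorial_one, show x i + s + ((1 : ℕ) : ℂ) * δ = δ + s + x i by push_cast; ring,
      show x i + s + ((1 + α i : ℕ) : ℂ) * δ = δ + s + x i - a i by
        rw [ha]; push_cast; ring] at e₂
    have h₁ := hreg.base_ne i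
    have h₂ := hreg.a_ne μ hμ i
    have h₃ : shiftedFactorial f δ (x i + s + ((∑ j, μ j : ℕ) : ℂ) * δ) (α i + 1) ≠ 0 := by
      refine right_ne_zero_of_mul (a := shiftedFactorial f δ (x i + s) (∑ l, μ l)) ?_
      rw [e₂]
      exact mul_ne_zero (mul_ne_zero h₁ (hs i)) h₂
    rw [div_mul_div_comm, div_mul_eq_mul_div, div_eq_div_iff h₃ (mul_ne_zero h₁ h₂),
      add_comm s (x i)]
    linear_combination -(f (x i + s + (((∑ j, μ j) + μ i : ℕ) : ℂ) * δ)) * e₂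
  have hC : ∀ k, upperWeight f δ α x s (c k) μ * lowerWeight f δ α x s (d k) μ =
      (shiftedFactorial f δ (δ + s - c k) (∑ i, α i) *
        ∏ i, shiftedFactorial f δ (δ + s + x i - d k) (α i)) *
      (shiftedFactorial f δ (d k) (∑ l, μ l) / shiftedFactorial f δ (δ + s - c k) (∑ l, μ l) *
      ∏ i, shiftedFactorial f δ (x i + c k) (μ i) /
        shiftedFactorial f δ (x i + δ + s - d k) (μ i)) := by
    intro k
    have h₁ := hreg.u_ne μ hμ k
    have e₁ := shiftedFactorial_add f δ (δ + s - c k) (∑ l, μ l) (∑ i, α i - ∑ l, μ l)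
    rw [Nat.add_sub_cancel' hle] at e₁
    have e₂ : ∏ i, shiftedFactorial f δ (δ + s + x i - d k) (α i) =
        (∏ i, shiftedFactorial f δ (x i + δ + s - d k) (μ i)) *
          ∏ i, shiftedFactorial f δ (x i + μ i * δ + (δ + s - d k)) (α i - μ i) := by
      rw [← prod_mul_distrib]
      refine prod_congr rfl fun i _ => ?_
      have := shiftedFactorial_add f δ (x i + δ + s - d k) (μ i) (α i - μ i)
      rw [Nat.add_sub_cancel' (hμ i)] at this
      rw [show δ + s + x i - d k = x i + δ + s - d k by ring, this]
      congr 2; ring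
    have h₂ : ∏ i, shiftedFactorial f δ (x i + δ + s - d k) (μ i) ≠ 0 :=
      prod_ne_zero_iff.mpr fun i _ => hreg.v_ne μ hμ i k
    rw [upperWeight, lowerWeight, e₁, e₂, prod_div_distrib]
    field_simp
  have hA := differenceWeight_eq hf ha hreg.difference_ne (hreg.x_ne μ hμ)
  rw [normalizedTerm, vwpTerm, prod_congr rfl fun k _ => hC k, prod_mul_distrib, prod_mul_distrib,
    normFactor, hA, prod_mul_distrib (s := univ) (f := fun j =>
      shiftedFactorial f δ (s + x j) (∑ l, μ l) /
        shiftedFactorial f δ (δ + s + x j - a j) (∑ l, μ l))]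
  generalize (∏ k, shiftedFactorial f δ (d k) (∑ l, μ l) /
    shiftedFactorial f δ (δ + s - c k) (∑ l, μ l) * ∏ i, shiftedFactorial f δ (x i + c k) (μ i) /
        shiftedFactorial f δ (x i + δ + s - d k) (μ i)) = G
  generalize (∏ k, shiftedFactorial f δ (δ + s - c k) (∑ i, α i)) = G₁
  generalize (∏ k, ∏ i, shiftedFactorial f δ (δ + s + x i - d k) (α i)) = G₂
  generalize (∏ j, ∏ i, shiftedFactorial f δ (x i - x j + a j) (μ i) /
          shiftedFactorial f δ (x i - x j + δ) (μ i)) = G₃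
  generalize differenceProduct f (fun i => x i + (μ i : ℂ) * δ) / differenceProduct f x = G₄
  linear_combination G * G₁ * G₂ * G₃ * G₄ * hB

theorem normalizedSeries_mul_poleFactor (hf : IsRiemannBracket f) {α : Fin m → ℕ}
    {a x : Fin m → ℂ} {s : ℂ} {c d : Fin 3 → ℂ} (ha : ∀ i, a i = -(α i : ℂ) * δ)
    (hreg : VwpRegular f δ a x s c d α)
    (hs : ∀ i, shiftedFactorial f δ (δ + s + x i) (α i) ≠ 0) :
    normalizedSeries f δ α x s c d * poleFactor f δ α x s =
      normFactor f δ α x s c d * vwpSeries f δ a x s c d := by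
  rw [vwpSeries_eq_sum hf δ a x s c d α ha, normalizedSeries, sum_mul, mul_sum]
  exact sum_congr rfl fun μ hμ =>
    normalizedTerm_mul_poleFactor hf.odd ha hreg hs (mem_Iic.mp hμ)

theorem VwpRegular.of_avoids (hδ : ∀ k : ℤ, k ≠ 0 → f ((k : ℂ) * δ) ≠ 0) {n : ℕ} {α : Fin m → ℕ}
    {a x : Fin m → ℂ} {s : ℂ} {c d : Fin n → ℂ} (ha : ∀ i, a i = -(α i : ℂ) * δ)
    (hg : GenericBase f δ x s) (hc : ∀ k, Avoids f δ (s - c k))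
    (hd : ∀ i k, Avoids f δ (x i + s - d k)) : VwpRegular f δ a x s c d α where
  difference_ne := prod_ne_zero_iff.mpr fun i _ => prod_ne_zero_iff.mpr fun j hj =>
    (hg.sub i j (mem_Ioi.mp hj).ne).ne 0 (by simp)
  base_ne i := (hg.add i).ne 0 (by simp)
  a_ne μ _ j := (hg.add j).shiftedFactorial_ne (α j + 1) _ (by rw [ha]; push_cast; ring)
  x_ne μ _ i j := by
    by_cases h : i = j
    · subst h
      refine shiftedFactorial_ne_zero fun t _ => ?_
      have e := hδ (t + 1) (by omega)
      convert e using 2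
      push_cast; ring
    · exact (hg.sub i j h).shiftedFactorial_ne 1 _ (by push_cast; ring)
  u_ne μ _ k := (hc k).shiftedFactorial_ne 1 _ (by push_cast; ring)
  v_ne μ _ i k := (hd i k).shiftedFactorial_ne 1 _ (by push_cast; ring)

end Conversion

/-! ### Extension from generic parameters by continuity -/

section Path

variable {f : ℂ → ℂ} {δ : ℂ} {m : ℕ}

theorem continuous_shiftedFactorial (hf : IsRiemannBracket f) (k : ℕ) :
    Continuous fun x => shiftedFactorial f δ x k :=
  continuous_finsetProd _ fun _ _ => hf.holomorphic.continuous.comp (by fun_prop)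

theorem continuous_differenceProduct (hf : IsRiemannBracket f) :
    Continuous fun z : Fin m → ℂ => differenceProduct f z :=
  continuous_finsetProd _ fun _ _ => continuous_finsetProd _ fun _ _ =>
    hf.holomorphic.continuous.comp (by fun_prop)

theorem continuousAt_vwpSeries (hf : IsRiemannBracket f) {n : ℕ} {α : Fin m → ℕ}
    {a : Fin m → ℂ} (ha : ∀ i, a i = -(α i : ℂ) * δ) {x : ℂ → Fin m → ℂ} {s : ℂ → ℂ}
    {c d : ℂ → Fin n → ℂ} (hx : Continuous x) (hs : Continuous s) (hc : Continuous c)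
    (hd : Continuous d) {z : ℂ} (hreg : VwpRegular f δ a (x z) (s z) (c z) (d z) α) :
    ContinuousAt (fun z => vwpSeries f δ a (x z) (s z) (c z) (d z)) z := by
  simp only [vwpSeries_eq_sum hf δ a _ _ _ _ α ha]
  have hf' : Continuous f := hf.holomorphic.continuous
  have hx' : ∀ i, Continuous fun z => x z i := fun i => (continuous_apply i).comp hx
  have hc' : ∀ k, Continuous fun z => c z k := fun k => (continuous_apply k).comp hc
  have hd' : ∀ k, Continuous fun z => d z k := fun k => (continuous_apply k).comp hd
  have hsf : ∀ {g : ℂ → ℂ} (k : ℕ), Continuous g →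
      ContinuousAt (fun z => shiftedFactorial f δ (g z) k) z := fun k hg =>
    ((continuous_shiftedFactorial hf k).comp hg).continuousAt
  refine tendsto_finsetSum _ fun μ hμ => ?_
  have hμ : μ ≤ α := mem_Iic.mp hμ
  refine ContinuousAt.mul (ContinuousAt.mul (ContinuousAt.mul ?_ ?_) ?_) ?_
  · refine ContinuousAt.div ?_ ?_ hreg.difference_ne
    · exact ((continuous_differenceProduct hf).comp
        (continuous_pi fun i => (hx' i).add continuous_const)).continuousAt
    · exact ((continuous_differenceProduct hf).comp hx).continuousAt
  · refine tendsto_finsetProd _ fun i _ => ContinuousAt.div ?_ ?_ (hreg.base_ne i)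
    · exact (hf'.comp (((hx' i).add hs).add continuous_const)).continuousAt
    · exact (hf'.comp ((hx' i).add hs)).continuousAt
  · refine tendsto_finsetProd _ fun j _ => ContinuousAt.mul ?_ ?_
    · exact (hsf _ (hs.add (hx' j))).div
        (hsf _ (((continuous_const.add hs).add (hx' j)).sub continuous_const)) (hreg.a_ne μ hμ j)
    · exact tendsto_finsetProd _ fun i _ => ContinuousAt.div
        (hsf _ (((hx' i).sub (hx' j)).add continuous_const))
        (hsf _ (((hx' i).sub (hx' j)).add continuous_const)) (hreg.x_ne μ hμ i j)
  · refine tendsto_finsetProd _ fun k _ => ContinuousAt.mul ?_ ?_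
    · exact (hsf _ (hd' k)).div (hsf _ ((continuous_const.add hs).sub (hc' k)))
        (hreg.u_ne μ hμ k)
    · exact tendsto_finsetProd _ fun i _ => ContinuousAt.div
        (hsf _ ((hx' i).add (hc' k)))
        (hsf _ ((((hx' i).add continuous_const).add hs).sub (hd' k))) (hreg.v_ne μ hμ i k)

theorem continuous_normFactor (hf : IsRiemannBracket f) (α : Fin m → ℕ) {x : ℂ → Fin m → ℂ}
    {s : ℂ → ℂ} {c d : ℂ → Fin 3 → ℂ} (hx : Continuous x) (hs : Continuous s) (hc : Continuous c)
    (hd : Continuous d) : Continuous fun z => normFactor f δ α (x z) (s z) (c z) (d z) := by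
  refine Continuous.mul ?_ ?_
  · exact continuous_finsetProd _ fun k _ => (continuous_shiftedFactorial hf _).comp
      ((continuous_const.add hs).sub ((continuous_apply k).comp hc))
  · exact continuous_finsetProd _ fun k _ => continuous_finsetProd _ fun i _ =>
      (continuous_shiftedFactorial hf _).comp
        (((continuous_const.add hs).add ((continuous_apply i).comp hx)).sub
          ((continuous_apply k).comp hd))

theorem continuous_poleFactor (hf : IsRiemannBracket f) (α : Fin m → ℕ) {x : ℂ → Fin m → ℂ}
    {s : ℂ → ℂ} (hx : Continuous x) (hs : Continuous s) :
    Continuous fun z => poleFactor f δ α (x z) (s z) :=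
  continuous_finsetProd _ fun i _ => (continuous_shiftedFactorial hf _).comp
    ((continuous_const.add hs).add ((continuous_apply i).comp hx))

/-- The identity of two normalised series, in terms of `vwpSeries` and without division. -/
def CrossIdentity (f : ℂ → ℂ) (δ : ℂ) (α : Fin m → ℕ) (a x x' : Fin m → ℂ) (s s' : ℂ)
    (c c' d d' : Fin 3 → ℂ) : Prop :=
  normFactor f δ α x' s' c' d' * vwpSeries f δ a x' s' c' d' * poleFactor f δ α x s =
    normFactor f δ α x s c d * vwpSeries f δ a x s c d * poleFactor f δ α x' s'

/-- Genericity of the parameters of one series. -/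
structure SeriesGeneric (f : ℂ → ℂ) (δ : ℂ) (x : Fin m → ℂ) (s : ℂ) (c d : Fin 3 → ℂ) : Prop
    extends GenericBase f δ x s where
  upper : ∀ k, Avoids f δ (s - c k)
  lower : ∀ i k, Avoids f δ (x i + s - d k)

theorem SeriesGeneric.normalizedSeries_mul_poleFactor (hf : IsRiemannBracket f)
    (hδ : ∀ k : ℤ, k ≠ 0 → f ((k : ℂ) * δ) ≠ 0) {α : Fin m → ℕ}
    {a x : Fin m → ℂ} {s : ℂ} {c d : Fin 3 → ℂ} (ha : ∀ i, a i = -(α i : ℂ) * δ)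
    (h : SeriesGeneric f δ x s c d) :
    normalizedSeries f δ α x s c d * poleFactor f δ α x s =
      normFactor f δ α x s c d * vwpSeries f δ a x s c d :=
  _root_.normalizedSeries_mul_poleFactor hf ha
    (VwpRegular.of_avoids hδ ha h.toGenericBase h.upper h.lower)
    fun i => (h.add i).shiftedFactorial_ne 1 _ (by push_cast; ring)

theorem crossIdentity_of_normalizedSeries_eq (hf : IsRiemannBracket f)
    (hδ : ∀ k : ℤ, k ≠ 0 → f ((k : ℂ) * δ) ≠ 0) {α : Fin m → ℕ}
    {a x x' : Fin m → ℂ} {s s' : ℂ} {c c' d d' : Fin 3 → ℂ} (ha : ∀ i, a i = -(α i : ℂ) * δ)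
    (h : SeriesGeneric f δ x s c d) (h' : SeriesGeneric f δ x' s' c' d')
    (heq : normalizedSeries f δ α x' s' c' d' = normalizedSeries f δ α x s c d) :
    CrossIdentity f δ α a x x' s s' c c' d d' := by
  have e := h.normalizedSeries_mul_poleFactor hf hδ ha
  have e' := h'.normalizedSeries_mul_poleFactor hf hδ ha
  rw [CrossIdentity, ← e, ← e', heq]
  ring

/-- A set of full measure is dense, and both sides are continuous at a regular point, so their
difference vanishes there. As nothing is divided, zeros of the normalising factors do no harm. -/
theorem crossIdentity_of_ae (hf : IsRiemannBracket f) {α : Fin m → ℕ} {a : Fin m → ℂ}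
    (ha : ∀ i, a i = -(α i : ℂ) * δ) {x x' : ℂ → Fin m → ℂ} {s s' : ℂ → ℂ}
    {c c' d d' : ℂ → Fin 3 → ℂ} (hx : Continuous x) (hx' : Continuous x') (hs : Continuous s)
    (hs' : Continuous s') (hc : Continuous c) (hc' : Continuous c') (hd : Continuous d)
    (hd' : Continuous d')
    (h : ∀ᵐ z : ℂ, CrossIdentity f δ α a (x z) (x' z) (s z) (s' z) (c z) (c' z) (d z) (d' z))
    {z : ℂ} (hreg : VwpRegular f δ a (x z) (s z) (c z) (d z) α)
    (hreg' : VwpRegular f δ a (x' z) (s' z) (c' z) (d' z) α) :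
    CrossIdentity f δ α a (x z) (x' z) (s z) (s' z) (c z) (c' z) (d z) (d' z) := by
  have h₁ := ((continuous_normFactor (δ := δ) hf α hx' hs' hc' hd').continuousAt.mul
    (continuousAt_vwpSeries hf ha hx' hs' hc' hd' hreg')).mul
    (continuous_poleFactor (δ := δ) hf α hx hs).continuousAt
  have h₂ := ((continuous_normFactor (δ := δ) hf α hx hs hc hd).continuousAt.mul
    (continuousAt_vwpSeries hf ha hx hs hc hd hreg)).mul
    (continuous_poleFactor (δ := δ) hf α hx' hs').continuousAt
  have hfreq := mem_closure_iff_frequently.mp ((Measure.dense_of_ae h) z)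
  have h0 := (isClosed_singleton (x := (0 : ℂ))).mem_of_frequently_of_tendsto
    (hfreq.mono fun w hw => sub_eq_zero.mpr hw) (h₁.sub h₂)
  exact sub_eq_zero.mp h0

/-! ### Generic points on complex lines in parameter space -/

/-- The x_i move in imaginary directions and all other parameters in real ones. A linear form whose
velocity has nonzero real part n is then nonconstant, whatever x_i contribute, so genericity reduces
to checking finitely many real numbers. -/
theorem ae_avoids_path (hf : IsRiemannBracket f) (w : ℂ → ℂ) (n k : ℝ) (hn : n ≠ 0)
    (hw : ∀ z, w z = w 0 + z * (n + k * Complex.I)) : ∀ᵐ z : ℂ, Avoids f δ (w z) := by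
  have hB : (n + k * Complex.I : ℂ) ≠ 0 := fun h => hn (by simpa using congrArg Complex.re h)
  filter_upwards [hf.ae_avoids δ (w 0) hB] with z hz
  rwa [hw]

theorem ae_genericBase (hf : IsRiemannBracket f) (x : Fin m → ℂ) (s : ℂ) (X : Fin m → ℝ)
    (hX : Function.Injective X) (S : ℝ) (hS : S ≠ 0) :
    ∀ᵐ z : ℂ, GenericBase f δ (fun i => x i + z * (X i * Complex.I)) (s + z * S) := by
  have h₁ : ∀ᵐ z : ℂ, ∀ i j, i ≠ j →
      Avoids f δ (x i + z * (X i * Complex.I) - (x j + z * (X j * Complex.I))) := by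
    refine ae_all_iff.mpr fun i => ae_all_iff.mpr fun j => ?_
    by_cases h : i = j
    · exact Eventually.of_forall fun _ h' => absurd h h'
    · have hB : ((X i - X j : ℝ) * Complex.I : ℂ) ≠ 0 :=
        mul_ne_zero (Complex.ofReal_ne_zero.mpr (sub_ne_zero.mpr (hX.ne h))) Complex.I_ne_zero
      filter_upwards [hf.ae_avoids δ (x i - x j) hB] with z hz _
      exact hz.shift 0 (by push_cast; ring)
  have h₂ : ∀ᵐ z : ℂ, ∀ i, Avoids f δ (x i + z * (X i * Complex.I) + (s + z * S)) :=
    ae_all_iff.mpr fun i => ae_avoids_path hf _ S (X i) hS fun z => by ring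
  filter_upwards [h₁, h₂] with z h₁ h₂ using ⟨h₁, h₂⟩

theorem ae_seriesGeneric (hf : IsRiemannBracket f) (x : Fin m → ℂ) (s : ℂ) (c d : Fin 3 → ℂ)
    (X : Fin m → ℝ) (hX : Function.Injective X) (S : ℝ) (C D : Fin 3 → ℝ) (hS : S ≠ 0)
    (hC : ∀ k, S - C k ≠ 0) (hD : ∀ k, S - D k ≠ 0) :
    ∀ᵐ z : ℂ, SeriesGeneric f δ (fun i => x i + z * (X i * Complex.I)) (s + z * S)
      (fun k => c k + z * C k) (fun k => d k + z * D k) := by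
  have h₁ : ∀ᵐ z : ℂ, ∀ k, Avoids f δ (s + z * S - (c k + z * C k)) :=
    ae_all_iff.mpr fun k => ae_avoids_path hf _ _ 0 (hC k) fun z => by push_cast; ring
  have h₂ : ∀ᵐ z : ℂ, ∀ i k,
      Avoids f δ (x i + z * (X i * Complex.I) + (s + z * S) - (d k + z * D k)) :=
    ae_all_iff.mpr fun i => ae_all_iff.mpr fun k =>
      ae_avoids_path hf _ _ (X i) (hD k) fun z => by push_cast; ring
  filter_upwards [ae_genericBase hf x s X hX S hS, h₁, h₂] with z h₀ h₁ h₂ using ⟨h₀, h₁, h₂⟩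

theorem ae_baileyGeneric (hf : IsRiemannBracket f) (x : Fin m → ℂ) (s c D e : ℂ)
    (X : Fin m → ℝ) (hX : Function.Injective X) (S C D' E : ℝ) (hS : S ≠ 0) (hC : C ≠ 0)
    (h₁ : 2 * S - D' ≠ 0) (h₂ : 2 * S - C - D' ≠ 0) (h₃ : 3 * S - C - D' - E ≠ 0)
    (h₄ : 2 * S - C - D' - E ≠ 0) :
    ∀ᵐ z : ℂ, BaileyGeneric f δ (fun i => x i + z * (X i * Complex.I)) (s + z * S)
      (c + z * C) (D + z * D') (e + z * E) := by
  have g₀ : ∀ᵐ z : ℂ, ∀ i, Avoids f δ (x i + z * (X i * Complex.I) + (c + z * C)) :=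
    ae_all_iff.mpr fun i => ae_avoids_path hf _ C (X i) hC fun z => by ring
  have g₁ : ∀ᵐ z : ℂ, ∀ i j, Avoids f δ (x i + z * (X i * Complex.I) +
      (x j + z * (X j * Complex.I)) + 2 * (s + z * S) - (D + z * D')) :=
    ae_all_iff.mpr fun i => ae_all_iff.mpr fun j =>
      ae_avoids_path hf _ _ (X i + X j) h₁ fun z => by push_cast; ring
  have g₂ : ∀ᵐ z : ℂ, ∀ i, Avoids f δ (x i + z * (X i * Complex.I) + 2 * (s + z * S) -
      (c + z * C) - (D + z * D')) :=
    ae_all_iff.mpr fun i => ae_avoids_path hf _ _ (X i) h₂ fun z => by push_cast; ring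
  have g₃ : ∀ᵐ z : ℂ, ∀ i j, Avoids f δ (x i + z * (X i * Complex.I) +
      (x j + z * (X j * Complex.I)) + 3 * (s + z * S) - (c + z * C) - (D + z * D') -
        (e + z * E)) :=
    ae_all_iff.mpr fun i => ae_all_iff.mpr fun j =>
      ae_avoids_path hf _ _ (X i + X j) h₃ fun z => by push_cast; ring
  have g₄ : ∀ᵐ z : ℂ, ∀ i, Avoids f δ (x i + z * (X i * Complex.I) + 2 * (s + z * S) -
      (c + z * C) - (D + z * D') - (e + z * E)) :=
    ae_all_iff.mpr fun i => ae_avoids_path hf _ _ (X i) h₄ fun z => by push_cast; ring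
  filter_upwards [ae_genericBase hf x s X hX S hS, g₀, g₁, g₂, g₃, g₄] with z b g₀ g₁ g₂ g₃ g₄
  exact { toGenericBase := b, upper := g₀, pair := g₁, base := g₂, pair' := g₃, base' := g₄ }

end Path

/-! ### Removal of genericity and the two transformations -/

section Main

variable {f : ℂ → ℂ} {δ : ℂ} {m : ℕ}

theorem injective_cast_fin : Function.Injective fun i : Fin m => ((i : ℕ) : ℝ) :=
  fun _ _ h => Fin.ext (Nat.cast_injective h)

theorem sum_eq_neg_mul {a : Fin m → ℂ} {α : Fin m → ℕ} (ha : ∀ i, a i = -(α i : ℂ) * δ) :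
    ∑ i, a i = -(((∑ i, α i : ℕ) : ℂ) * δ) := by
  push_cast
  rw [sum_mul, ← sum_neg_distrib]
  exact sum_congr rfl fun i _ => by rw [ha]; ring

theorem crossIdentity_bailey (hf : IsRiemannBracket f)
    (hδ : ∀ k : ℤ, k ≠ 0 → f ((k : ℂ) * δ) ≠ 0) (α : Fin m → ℕ) (a x : Fin m → ℂ) (s : ℂ)
    (c d : Fin 3 → ℂ) (hbal : (∑ i, a i) + ∑ k, (c k + d k) = 2 * δ + 3 * s)
    (ha : ∀ i, a i = -(α i : ℂ) * δ) (hreg : VwpRegular f δ a x s c d α) (s' : ℂ)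
    (c' d' : Fin 3 → ℂ) (hs' : s' = δ + 2 * s - c 2 - d 0 - d 1)
    (hc' : c' = ![c 0, c 1, δ + s - d 0 - d 1])
    (hd' : d' = ![δ + s - c 2 - d 1, δ + s - c 2 - d 0, d 2])
    (hreg' : VwpRegular f δ a x s' c' d' α) :
    CrossIdentity f δ α a x x s s' c c' d d' := by
  rw [sum_eq_neg_mul ha, Fin.sum_univ_three] at hbal
  -- The velocities of c, d and s satisfy -5 + 1 + 1 + 0 = 3·(-1), so the line preserves the
  -- balancing condition; those of s', c', d' follow from their formulas. They are chosen so that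
  -- every form required to be generic really moves.
  have key := crossIdentity_of_ae hf ha (z := 0)
    (x := fun z i => x i + z * (((i : ℕ) : ℝ) * Complex.I))
    (x' := fun z i => x i + z * (((i : ℕ) : ℝ) * Complex.I))
    (s := fun z => s + z * ((-1 : ℝ) : ℂ)) (s' := fun z => s' + z * ((-3 : ℝ) : ℂ))
    (c := fun z k => c k + z * ((![-5, 1, 1] k : ℝ) : ℂ))
    (c' := fun z k => c' k + z * ((![-5, 1, -1] k : ℝ) : ℂ))
    (d := fun z k => d k + z * ((![0, 0, 0] k : ℝ) : ℂ))
    (d' := fun z k => d' k + z * ((![-2, -2, 0] k : ℝ) : ℂ))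
    (by fun_prop) (by fun_prop) (by fun_prop) (by fun_prop) (by fun_prop) (by fun_prop)
    (by fun_prop) (by fun_prop) ?_ (by simpa using hreg) (by simpa using hreg')
  · simpa using key
  filter_upwards [ae_seriesGeneric hf x s c d _ injective_cast_fin (-1) ![-5, 1, 1] ![0, 0, 0]
      (by norm_num) (by intro k; fin_cases k <;> norm_num) (by intro k; fin_cases k <;> norm_num),
    ae_seriesGeneric hf x s' c' d' _ injective_cast_fin (-3) ![-5, 1, -1] ![-2, -2, 0]
      (by norm_num) (by intro k; fin_cases k <;> norm_num) (by intro k; fin_cases k <;> norm_num),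
    ae_baileyGeneric hf x s (c 2) (d 0 + d 1) (d 2) _ injective_cast_fin (-1) 1 0 0
      (by norm_num) (by norm_num) (by norm_num) (by norm_num) (by norm_num) (by norm_num)]
    with z g g' b
  refine crossIdentity_of_normalizedSeries_eq hf hδ ha g g' ?_
  have e := normalizedSeries_bailey hf hδ _ α _ _ (c 0 - z * 5) (c 1 + z) _ (d 0) (d 1) _
    (δ + s - c 2 - d 0 - d 1 - 2 * z) rfl (by convert b using 1; simp) (by push_cast; ring)
    (by push_cast; push_cast at hbal; linear_combination hbal)
  refine Eq.trans ?_ (e.symm.trans ?_)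
  · congr 1
    · rw [hs']; push_cast; ring
    · funext k
      fin_cases k <;> simp [hc'] <;> ring
    · funext k
      fin_cases k <;> simp [hd'] <;> ring
  · congr 1
    · funext k
      fin_cases k <;> simp
      ring
    · funext k
      fin_cases k <;> simp

theorem crossIdentity_reversed_bailey (hf : IsRiemannBracket f)
    (hδ : ∀ k : ℤ, k ≠ 0 → f ((k : ℂ) * δ) ≠ 0) (α : Fin m → ℕ) (a x : Fin m → ℂ) (s : ℂ)
    (c d : Fin 3 → ℂ) (hbal : (∑ i, a i) + ∑ k, (c k + d k) = 2 * δ + 3 * s)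
    (ha : ∀ i, a i = -(α i : ℂ) * δ) (hreg : VwpRegular f δ a x s c d α) (s' : ℂ)
    (c' : Fin 3 → ℂ) (x' : Fin m → ℂ) (hs' : s' = δ + 2 * s - c 0 - c 1 - c 2)
    (hc' : c' = ![δ + s - c 1 - c 2, δ + s - c 0 - c 2, δ + s - c 0 - c 1])
    (hx' : ∀ i, x' i = a i - x i - ∑ j, a j)
    (hreg' : VwpRegular f δ a x' s' c' d α) :
    CrossIdentity f δ α a x x' s s' c c' d d := by
  obtain ⟨K, hK⟩ : ∃ K : ℂ, K = ((∑ i, α i : ℕ) : ℂ) := ⟨_, rfl⟩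
  have hsum := sum_eq_neg_mul ha
  rw [← hK] at hsum
  rw [hsum, Fin.sum_univ_three] at hbal
  have hX' : Function.Injective fun i : Fin m => -((i : ℕ) : ℝ) :=
    neg_injective.comp injective_cast_fin
  -- The same line as for (I); the formulas for x', s', c' give the velocities -i·I, 1 and (-3, 3,
  -- 3). The shifts r₂, r₁, r₀ move with velocities -2, -2, 4.
  have key := crossIdentity_of_ae hf ha (z := 0)
    (x := fun z i => x i + z * (((i : ℕ) : ℝ) * Complex.I))
    (x' := fun z i => x' i + z * ((-((i : ℕ) : ℝ) : ℝ) * Complex.I))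
    (s := fun z => s + z * ((-1 : ℝ) : ℂ)) (s' := fun z => s' + z * ((1 : ℝ) : ℂ))
    (c := fun z k => c k + z * ((![-5, 1, 1] k : ℝ) : ℂ))
    (c' := fun z k => c' k + z * ((![-3, 3, 3] k : ℝ) : ℂ))
    (d := fun z k => d k + z * ((![0, 0, 0] k : ℝ) : ℂ))
    (d' := fun z k => d k + z * ((![0, 0, 0] k : ℝ) : ℂ))
    (by fun_prop) (by fun_prop) (by fun_prop) (by fun_prop) (by fun_prop) (by fun_prop)
    (by fun_prop) (by fun_prop) ?_ (by simpa using hreg) (by simpa using hreg')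
  · simpa using key
  set r₂ := δ + s - c 2 - d 0 - d 1 with hr₂
  set r₁ := δ + s - c 1 - d 0 - d 2 with hr₁
  set r₀ := δ + s - c 0 - d 1 - d 2 with hr₀
  filter_upwards [ae_seriesGeneric hf x s c d _ injective_cast_fin (-1) ![-5, 1, 1] ![0, 0, 0]
      (by norm_num) (by intro k; fin_cases k <;> norm_num) (by intro k; fin_cases k <;> norm_num),
    ae_seriesGeneric hf x' s' c' d _ hX' 1 ![-3, 3, 3] ![0, 0, 0]
      (by norm_num) (by intro k; fin_cases k <;> norm_num) (by intro k; fin_cases k <;> norm_num),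
    ae_baileyGeneric hf x s (c 2) (d 0 + d 1) (d 2) _ injective_cast_fin (-1) 1 0 0
      (by norm_num) (by norm_num) (by norm_num) (by norm_num) (by norm_num) (by norm_num),
    ae_baileyGeneric hf x (s + r₂) (c 1) (d 0 + r₂ + d 2) (d 1 + r₂) _ injective_cast_fin
      (-3) 1 (-2) (-2)
      (by norm_num) (by norm_num) (by norm_num) (by norm_num) (by norm_num) (by norm_num),
    ae_baileyGeneric hf x (s + r₂ + r₁) (c 0) (d 1 + r₂ + (d 2 + r₁)) (d 0 + r₂ + r₁) _
      injective_cast_fin (-5) (-5) (-4) (-4)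
      (by norm_num) (by norm_num) (by norm_num) (by norm_num) (by norm_num) (by norm_num)]
    with z g g' b₂ b₁ b₀
  refine crossIdentity_of_normalizedSeries_eq hf hδ ha g g' ?_
  have e := normalizedSeries_reversed_bailey hf hδ α
    (fun i => x i + z * (((i : ℕ) : ℝ) * Complex.I)) (s + z * ((-1 : ℝ) : ℂ)) (c 0 - z * 5)
    (c 1 + z * ((1 : ℝ) : ℂ)) (c 2 + z * ((1 : ℝ) : ℂ)) (d 0) (d 1) (d 2)
    (r₂ - 2 * z) (r₁ - 2 * z) (r₀ + 4 * z) K hK (by rw [hr₂]; push_cast; ring)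
    (by rw [hr₁]; push_cast; ring) (by rw [hr₀]; push_cast; ring)
    (by convert b₂ using 1 <;> push_cast <;> ring) (by convert b₁ using 1 <;> push_cast <;> ring)
    (by convert b₀ using 1 <;> push_cast <;> ring)
    (by push_cast; linear_combination hbal)
  refine Eq.trans ?_ (e.trans ?_)
  · congr 1
    · funext i
      rw [hx', hsum, ha]; push_cast; ring
    · rw [hs']; push_cast; ring
    · funext k
      fin_cases k <;> simp [hc'] <;> ring
    · funext k
      fin_cases k <;> simp
  · congr 1
    · funext k
      fin_cases k <;> simp
      ring
    · funext k
      fin_cases k <;> simp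

end Main

theorem mainTheorem4 (f : ℂ → ℂ) (hf : IsRiemannBracket f)
    (δ : ℂ) (hδ : ∀ k : ℤ, k ≠ 0 → f ((k : ℂ) * δ) ≠ 0)
    (m : ℕ) (α : Fin m → ℕ) (a x : Fin m → ℂ) (s : ℂ) (c d : Fin 3 → ℂ)
    (hbal : (∑ i, a i) + ∑ k, (c k + d k) = 2 * δ + 3 * s)
    (ha : ∀ i, a i = -(α i : ℂ) * δ)
    (hreg : VwpRegular f δ a x s c d α) :
    (∀ (s' : ℂ) (c' d' : Fin 3 → ℂ),
     s' = δ + 2 * s - c 2 - d 0 - d 1 →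
     c' = ![c 0, c 1, δ + s - d 0 - d 1] →
     d' = ![δ + s - c 2 - d 1, δ + s - c 2 - d 0, d 2] →
     VwpRegular f δ a x s' c' d' α →
     shiftedFactorial f δ (δ + s - c 0 - d 2) (∑ i, α i) ≠ 0 →
     shiftedFactorial f δ (δ + s - c 1 - d 2) (∑ i, α i) ≠ 0 →
     (∀ i, shiftedFactorial f δ (δ + s + x i) (α i) ≠ 0) →
     (∀ i, shiftedFactorial f δ
        (δ + s - x i + a i - (∑ j, a j) - c 0 - c 1) (α i) ≠ 0) →
     vwpSeries f δ a x s' c' d' =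
      (shiftedFactorial f δ (δ + s - c 0) (∑ i, α i) *
          shiftedFactorial f δ (δ + s - c 1) (∑ i, α i)) /
        (shiftedFactorial f δ (δ + s - c 0 - d 2) (∑ i, α i) *
          shiftedFactorial f δ (δ + s - c 1 - d 2) (∑ i, α i)) *
      (∏ i, (shiftedFactorial f δ (δ + s + x i - d 2) (α i) *
          shiftedFactorial f δ
            (δ + s - x i + a i - (∑ j, a j) - c 0 - c 1 - d 2) (α i)) /
        (shiftedFactorial f δ (δ + s + x i) (α i) *
          shiftedFactorial f δ
            (δ + s - x i + a i - (∑ j, a j) - c 0 - c 1) (α i))) *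
      vwpSeries f δ a x s c d) ∧
    (∀ (s' : ℂ) (c' : Fin 3 → ℂ) (x' : Fin m → ℂ),
     s' = δ + 2 * s - c 0 - c 1 - c 2 →
     c' = ![δ + s - c 1 - c 2, δ + s - c 0 - c 2, δ + s - c 0 - c 1] →
     (∀ i, x' i = a i - x i - ∑ j, a j) →
     VwpRegular f δ a x' s' c' d α →
     (∀ i, shiftedFactorial f δ (δ + s + x i) (α i) ≠ 0) →
     (∀ i, shiftedFactorial f δ (δ + s + x i - d 0 - d 1) (α i) ≠ 0) →
     (∀ i, shiftedFactorial f δ (δ + s + x i - d 0 - d 2) (α i) ≠ 0) →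
     (∀ i, shiftedFactorial f δ (δ + s + x i - d 1 - d 2) (α i) ≠ 0) →
     vwpSeries f δ a x' s' c' d =
      (∏ i, (shiftedFactorial f δ (δ + s + x i - d 0) (α i) *
          shiftedFactorial f δ (δ + s + x i - d 1) (α i)) /
        (shiftedFactorial f δ (δ + s + x i) (α i) *
          shiftedFactorial f δ (δ + s + x i - d 0 - d 1) (α i))) *
      (∏ i, (shiftedFactorial f δ (δ + s + x i - d 2) (α i) *
          shiftedFactorial f δ (δ + s + x i - d 0 - d 1 - d 2) (α i)) /
        (shiftedFactorial f δ (δ + s + x i - d 0 - d 2) (α i) *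
          shiftedFactorial f δ (δ + s + x i - d 1 - d 2) (α i))) *
      vwpSeries f δ a x s c d) := by
  have hsum := sum_eq_neg_mul ha
  have hbal' := hbal
  rw [hsum, Fin.sum_univ_three] at hbal'
  refine ⟨fun s' c' d' hs' hc' hd' hreg' hB₀ hB₁ hP hR => ?_,
    fun s' c' x' hs' hc' hx' hreg' hP h₀₁ h₀₂ h₁₂ => ?_⟩
  · have key := crossIdentity_bailey hf hδ α a x s c d hbal ha hreg s' c' d' hs' hc' hd' hreg'
    -- Regularity at the top index μ = α says that the full normalising factors are nonzero, so
    -- those common to both sides can be cancelled.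
    have hC₂ := hreg.u_ne α le_rfl 2
    have hQ : ∀ k, ∏ i, shiftedFactorial f δ (δ + s + x i - d k) (α i) ≠ 0 := fun k =>
      prod_ne_zero_iff.mpr fun i _ => by
        have := hreg.v_ne α le_rfl i k
        rwa [show x i + δ + s - d k = δ + s + x i - d k by ring] at this
    have hP' := prod_ne_zero_iff.mpr fun i (_ : i ∈ univ) => hP i
    have hR' := prod_ne_zero_iff.mpr fun i (_ : i ∈ univ) => hR i
    have r₁ : shiftedFactorial f δ (δ + s' - c' 0) (∑ i, α i) =
        (-1) ^ (∑ i, α i) * shiftedFactorial f δ (δ + s - c 1 - d 2) (∑ i, α i) :=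
      shiftedFactorial_reflect_of_eq hf.odd (by
        simp only [hs', hc', Matrix.cons_val_zero]; linear_combination -hbal')
    have r₂ : shiftedFactorial f δ (δ + s' - c' 1) (∑ i, α i) =
        (-1) ^ (∑ i, α i) * shiftedFactorial f δ (δ + s - c 0 - d 2) (∑ i, α i) :=
      shiftedFactorial_reflect_of_eq hf.odd (by
        simp only [hs', hc', Matrix.cons_val_one, Matrix.cons_val_zero]
        linear_combination -hbal')
    have r₃ : δ + s' - c' 2 = δ + s - c 2 := by
      simp only [hs', hc', Matrix.cons_val]; ring
    have r₄ : ∀ i, δ + s' + x i - d' 0 = δ + s + x i - d 0 := fun i => by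
      simp only [hs', hd', Matrix.cons_val_zero]; ring
    have r₅ : ∀ i, δ + s' + x i - d' 1 = δ + s + x i - d 1 := fun i => by
      simp only [hs', hd', Matrix.cons_val_one, Matrix.cons_val_zero]; ring
    -- By balancing and a_i = -α_iδ, reflection turns the factors of the new series into those of
    -- the stated prefactor that contain a_i - |a|.
    have r₆ : ∏ i, shiftedFactorial f δ (δ + s' + x i - d' 2) (α i) = (-1) ^ (∑ i, α i) *
        ∏ i, shiftedFactorial f δ (δ + s - x i + a i - (∑ j, a j) - c 0 - c 1) (α i) := by
      rw [← prod_pow_eq_pow_sum, ← prod_mul_distrib]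
      refine prod_congr rfl fun i _ => shiftedFactorial_reflect_of_eq hf.odd ?_
      simp only [hs', hd', Matrix.cons_val, hsum, ha i]; linear_combination -hbal'
    have r₇ : ∏ i, shiftedFactorial f δ (δ + s' + x i) (α i) = (-1) ^ (∑ i, α i) *
        ∏ i, shiftedFactorial f δ (δ + s - x i + a i - (∑ j, a j) - c 0 - c 1 - d 2) (α i) := by
      rw [← prod_pow_eq_pow_sum, ← prod_mul_distrib]
      refine prod_congr rfl fun i _ => shiftedFactorial_reflect_of_eq hf.odd ?_
      simp only [hs', hsum, ha i]; linear_combination -hbal'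
    have hε : ((-1) ^ (∑ i, α i) * (-1) ^ (∑ i, α i) : ℂ) = 1 := by rw [← mul_pow]; simp
    simp only [CrossIdentity, normFactor, poleFactor, Fin.prod_univ_three] at key
    rw [r₁, r₂, r₃, prod_congr rfl fun i _ => by rw [r₄ i],
      prod_congr (s₁ := univ) (f := fun i => shiftedFactorial f δ (δ + s' + x i - d' 1) (α i)) rfl
        fun i _ => by rw [r₅ i], r₆, r₇] at key
    rw [prod_div_distrib, prod_mul_distrib, prod_mul_distrib, div_mul_div_comm,
      div_mul_eq_mul_div, eq_div_iff (mul_ne_zero (mul_ne_zero hB₀ hB₁) (mul_ne_zero hP' hR'))]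
    refine mul_left_cancel₀ (mul_ne_zero (mul_ne_zero hC₂ (hQ 0)) (hQ 1)) ?_
    generalize ((-1) ^ (∑ i, α i) : ℂ) = ε at *
    set E' := vwpSeries f δ a x s' c' d'
    set E := vwpSeries f δ a x s c d
    set B₀ := shiftedFactorial f δ (δ + s - c 0 - d 2) (∑ i, α i)
    set B₁ := shiftedFactorial f δ (δ + s - c 1 - d 2) (∑ i, α i)
    set A₀ := shiftedFactorial f δ (δ + s - c 0) (∑ i, α i)
    set A₁ := shiftedFactorial f δ (δ + s - c 1) (∑ i, α i)
    set A₂ := shiftedFactorial f δ (δ + s - c 2) (∑ i, α i)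
    set Q₀ := ∏ i, shiftedFactorial f δ (δ + s + x i - d 0) (α i)
    set Q₁ := ∏ i, shiftedFactorial f δ (δ + s + x i - d 1) (α i)
    set Q₂ := ∏ i, shiftedFactorial f δ (δ + s + x i - d 2) (α i)
    set P := ∏ i, shiftedFactorial f δ (δ + s + x i) (α i)
    set R := ∏ i, shiftedFactorial f δ (δ + s - x i + a i - (∑ j, a j) - c 0 - c 1) (α i)
    set Z := ∏ i, shiftedFactorial f δ
      (δ + s - x i + a i - (∑ j, a j) - c 0 - c 1 - d 2) (α i)
    linear_combination ε * key - (ε * ε + 1) * (A₂ * Q₀ * Q₁ * E' * B₀ * B₁ * P * R) * hε +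
      (A₂ * Q₀ * Q₁ * A₀ * A₁ * Q₂ * Z * E) * hε
  · have key := crossIdentity_reversed_bailey hf hδ α a x s c d hbal ha hreg s' c' x' hs' hc' hx'
      hreg'
    have hC : ∀ k, shiftedFactorial f δ (δ + s - c k) (∑ i, α i) ≠ 0 := fun k =>
      hreg.u_ne α le_rfl k
    have hP' := prod_ne_zero_iff.mpr fun i (_ : i ∈ univ) => hP i
    have h₀₁' := prod_ne_zero_iff.mpr fun i (_ : i ∈ univ) => h₀₁ i
    have h₀₂' := prod_ne_zero_iff.mpr fun i (_ : i ∈ univ) => h₀₂ i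
    have h₁₂' := prod_ne_zero_iff.mpr fun i (_ : i ∈ univ) => h₁₂ i
    have r₀ : δ + s' - c' 0 = δ + s - c 0 := by
      simp only [hs', hc', Matrix.cons_val_zero]; ring
    have r₁ : δ + s' - c' 1 = δ + s - c 1 := by
      simp only [hs', hc', Matrix.cons_val_one, Matrix.cons_val_zero]; ring
    have r₂ : δ + s' - c' 2 = δ + s - c 2 := by
      simp only [hs', hc', Matrix.cons_val]; ring
    -- Passing from x to x' reflects a factor carrying a subset of {d₀, d₁, d₂} into the one
    -- carrying the complementary subset.
    have refl_prod : ∀ w w' : ℂ, w + w' = -(d 0 + d 1 + d 2) →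
        ∏ i, shiftedFactorial f δ (δ + s' + x' i + w) (α i) = (-1) ^ (∑ i, α i) *
          ∏ i, shiftedFactorial f δ (δ + s + x i + w') (α i) := fun w w' hw => by
      rw [← prod_pow_eq_pow_sum, ← prod_mul_distrib]
      refine prod_congr rfl fun i _ => shiftedFactorial_reflect_of_eq hf.odd ?_
      rw [hx', hs', hsum, ha i]
      linear_combination hw - hbal'
    have q₀ := refl_prod (-d 0) (-d 1 - d 2) (by ring)
    have q₁ := refl_prod (-d 1) (-d 0 - d 2) (by ring)
    have q₂ := refl_prod (-d 2) (-d 0 - d 1) (by ring)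
    have q₃ := refl_prod 0 (-d 0 - d 1 - d 2) (by ring)
    simp only [← sub_eq_add_neg, add_zero, ← add_sub_assoc] at q₀ q₁ q₂ q₃
    have hε : ((-1) ^ (∑ i, α i) * (-1) ^ (∑ i, α i) : ℂ) = 1 := by rw [← mul_pow]; simp
    simp only [CrossIdentity, normFactor, poleFactor, Fin.prod_univ_three] at key
    rw [r₀, r₁, r₂, q₀, q₁, q₂, q₃] at key
    rw [prod_div_distrib, prod_div_distrib, prod_mul_distrib, prod_mul_distrib, prod_mul_distrib,
      prod_mul_distrib, div_mul_div_comm, div_mul_eq_mul_div,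
      eq_div_iff (mul_ne_zero (mul_ne_zero hP' h₀₁') (mul_ne_zero h₀₂' h₁₂'))]
    refine mul_left_cancel₀ (mul_ne_zero (mul_ne_zero (hC 0) (hC 1)) (hC 2)) ?_
    generalize ((-1) ^ (∑ i, α i) : ℂ) = ε at *
    set E' := vwpSeries f δ a x' s' c' d
    set E := vwpSeries f δ a x s c d
    set A₀ := shiftedFactorial f δ (δ + s - c 0) (∑ i, α i)
    set A₁ := shiftedFactorial f δ (δ + s - c 1) (∑ i, α i)
    set A₂ := shiftedFactorial f δ (δ + s - c 2) (∑ i, α i)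
    set Q₀ := ∏ i, shiftedFactorial f δ (δ + s + x i - d 0) (α i)
    set Q₁ := ∏ i, shiftedFactorial f δ (δ + s + x i - d 1) (α i)
    set Q₂ := ∏ i, shiftedFactorial f δ (δ + s + x i - d 2) (α i)
    set P := ∏ i, shiftedFactorial f δ (δ + s + x i) (α i)
    set P₀₁ := ∏ i, shiftedFactorial f δ (δ + s + x i - d 0 - d 1) (α i)
    set P₀₂ := ∏ i, shiftedFactorial f δ (δ + s + x i - d 0 - d 2) (α i)
    set P₁₂ := ∏ i, shiftedFactorial f δ (δ + s + x i - d 1 - d 2) (α i)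
    set Z := ∏ i, shiftedFactorial f δ (δ + s + x i - d 0 - d 1 - d 2) (α i)
    linear_combination ε * key -
      (ε * ε + 1) * (A₀ * A₁ * A₂ * E' * P * P₀₁ * P₀₂ * P₁₂) * hε +
      (A₀ * A₁ * A₂ * Q₀ * Q₁ * Q₂ * Z * E) * hε
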